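/- Let $K$ be a field, let $1\le m\le n$, and let $\lambda=(\lambda_1\ge\dots\ge\lambda_m)$ be a partition with $m\le\lambda_m$ and $\lambda_1\le n$. Put $R=K[x_1,\dots,x_n]$ and $\mu=(0,1,\dots,m-1)$. Let $I\subseteq R$ be the specialization of the generalized Ferrers ideal $I_{\lambda-\mu}=(x_iy_j : 1\le i\le m,\ \mu_i<j\le\lambda_i)\subseteq K[x_1,\dots,x_m,y_1,\dots,y_n]$, that is, the ideal generated by its image under the homomorphism $x_i\mapsto x_i$, $y_j\mapsto x_j$; thus $I=(x_ix_j : 1\le i\le m,\ i\le j\le\lambda_i)$. Let $m_I$ be the least common multiple of the minimal monomial generators of $I$, and let $\widehat I$ be the LCM-dual of $I$: the ideal generated by the monomials $m_I/f$, where $f$ runs over the minimal monomial generators of $I$. Let $X_\lambda$ be the following labeled polyhedral cell complex in the plane. Its vertices are the points $v_{i,j}=(i,j)$ with $i\le j$ and $x_ix_j\in I$, and $v_{i,j}$ is labeled by $m_I/(x_ix_j)$. Its edges are the segments joining $v_{i,j}$ to $v_{i+1,j}$ and $v_{i,j}$ to $v_{i,j+1}$ whenever both endpoints are vertices. Its two-dimensional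 cells are the unit squares with corners $v_{i,j},v_{i+1,j},v_{i+1,j+1},v_{i,j+1}$ whenever all four corners are vertices. Each cell $P$ is labeled by the least common multiple $\mathbf x^{\mathbf a_P}$ of the labels of its vertices. The incidence numbers $\epsilon(P,Q)\in\{1,-1\}$, for $Q$ a facet of $P$, are those for which the boundary of an edge is $v_{i,j}-v_{i+1,j}$, respectively $v_{i,j}-v_{i,j+1}$, and the boundary of a square is $$e_{(i,j),(i,j+1)}+e_{(i,j+1),(i+1,j+1)}-e_{(i+1,j),(i+1,j+1)}-e_{(i,j),(i+1,j)}.$$ Let $F_k(X_\lambda)$ be the set of $k$-dimensional cells, and let $$\mathcal F_{X_\lambda}:\quad 0\leftarrow R\xleftarrow{\partial_0}R^{F_0(X_\lambda)}\xleftarrow{\partial_1}R^{F_1(X_\lambda)}\xleftarrow{\partial_2}R^{F_2(X_\lambda)}\leftarrow 0$$ be the cellular free complex, in which the basis element $P$ has multidegree $\mathbf a_P$, $\partial_0(v)=\mathbf x^{\mathbf a_v}$ for vertices $v$, and $\partial_k(P)=\sum_{Q}\epsilon(P,Q)\,\mathbf x^{\mathbf a_P-\mathbf a_Q}\,Q$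 for $k\ge1$, the sum being over the facets $Q$ of $P$. Then $\mathcal F_{X_\lambda}$ provides the minimal free resolution of $\widehat I$: the image of $\partial_0$ is $\widehat I$, the complex $$0\leftarrow\widehat I\xleftarrow{\partial_0}R^{F_0(X_\lambda)}\xleftarrow{\partial_1}R^{F_1(X_\lambda)}\xleftarrow{\partial_2}R^{F_2(X_\lambda)}\leftarrow 0$$ is exact, its maps are homogeneous of degree zero for the $\mathbb N^n$-grading, and all entries of the matrices of $\partial_1$ and $\partial_2$ lie in $(x_1,\dots,x_n)$. The basis elements of $R^{F_k(X_\lambda)}$ all have total degree $m+\lambda_1-2+k$. Consequently $\mathcal F_{X_\lambda}$ is a free resolution of $R/\widehat I$, and if $\lambda\ne(1)$ it is a minimal one, that is, the image of $\partial_0$ also lies in $(x_1,\dots,x_n)$. -/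

import Mathlib

open MvPolynomial

noncomputable section

namespace LCMDual

/-! ## Generalized Ferrers ideals and their specializations

All indices are zero-based: row `i : Fin m` carries the variable `x_{i+1}`, column `j : Fin n`
the variable `y_{j+1}`. -/

/-- The generalized Ferrers ideal `I_{λ-μ} = (x_i y_j : μ_i < j ≤ λ_i)` of
`S = K[x_1,…,x_m,y_1,…,y_n]`. The index `j : Fin n` stands for the one-based index `j + 1`. -/
def generalizedFerrersIdeal (K : Type*) [Field K] {m : ℕ} (n : ℕ) (lam mu : Fin m → ℕ) :
    Ideal (MvPolynomial (Fin m ⊕ Fin n) K) :=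
  Ideal.span {f | ∃ (i : Fin m) (j : Fin n), mu i < j.val + 1 ∧ j.val + 1 ≤ lam i ∧
    f = X (Sum.inl i) * X (Sum.inr j)}

/-- The specialization homomorphism `K[x_1,…,x_m,y_1,…,y_n] → K[x_1,…,x_n]`, where `m ≤ n`,
with `x_i ↦ x_i` and `y_j ↦ x_j`. -/
def specialization (K : Type*) [Field K] {m n : ℕ} (hmn : m ≤ n) :
    MvPolynomial (Fin m ⊕ Fin n) K →ₐ[K] MvPolynomial (Fin n) K :=
  aeval (Sum.elim (fun i => X (Fin.castLE hmn i)) (fun j => X j))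

/-- The specialization of `I_{λ-μ}` for `μ = (0, 1, …, m-1)`. -/
def specializedFerrersIdeal (K : Type*) [Field K] {m n : ℕ} (hmn : m ≤ n) (lam : Fin m → ℕ) :
    Ideal (MvPolynomial (Fin n) K) :=
  (generalizedFerrersIdeal K n lam (fun i => i.val)).map (specialization K hmn)

/-! ## LCM-duals of monomial ideals -/

section Dual

variable {σ K : Type*} [Fintype σ] [Field K]

/-- The exponents of the minimal monomial generators of a monomial ideal: the monomials of `I`
that are minimal for divisibility. -/
def minGenExponents (I : Ideal (MvPolynomial σ K)) : Set (σ →₀ ℕ) :=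
  {u | Minimal (fun v => monomial v (1 : K) ∈ I) u}

/-- The exponent of `m_I`, the least common multiple of the minimal monomial generators of `I`.
(There are finitely many of them, so that every supremum here is a maximum.) -/
def lcmExponent (I : Ideal (MvPolynomial σ K)) : σ →₀ ℕ :=
  Finsupp.equivFunOnFinite.symm fun i => sSup ((fun u : σ →₀ ℕ => u i) '' minGenExponents I)

/-- The LCM-dual of a monomial ideal: generated by the `m_I / f`, for `f` a minimal monomial
generator of `I`. -/
def lcmDual (I : Ideal (MvPolynomial σ K)) : Ideal (MvPolynomial σ K) :=
  Ideal.span ((fun u => monomial (lcmExponent I - u) (1 : K)) '' minGenExponents I)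

end Dual

/-! ## Labeled polyhedral cell complexes and cellular free complexes -/

/-- A polyhedral cell complex in `ℝ^N` with an incidence function. The nonempty cells of dimension
`k` are indexed by `Cell k`; the polytope of a cell is the convex hull of its vertices. -/
structure PolyhedralCellComplex (N : ℕ) where
  /-- the cells of dimension `k` -/
  Cell : ℕ → Type
  fintypeCell : ∀ k, Fintype (Cell k)
  /-- the position of a vertex -/
  point : Cell 0 → Fin N → ℝ
  point_injective : Function.Injective point
  /-- the vertices of a cell -/
  vertices : ∀ {k}, Cell k → Finset (Cell 0)
  vertices_nonempty : ∀ {k} (P : Cell k), (vertices P).Nonempty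
  vertices_zero : ∀ v : Cell 0, vertices v = {v}
  vertices_injective : ∀ k, Function.Injective (vertices : Cell k → Finset (Cell 0))
  /-- the polytope of a cell in `Cell k` has dimension `k` -/
  dim_eq : ∀ {k} (P : Cell k),
    Module.finrank ℝ (vectorSpan ℝ (convexHull ℝ (point '' (vertices P : Set (Cell 0))))) = k
  /-- every nonempty face of a polytope of the complex is a polytope of the complex -/
  face_mem : ∀ {k} (P : Cell k) (F : Set (Fin N → ℝ)),
    IsExposed ℝ (convexHull ℝ (point '' (vertices P : Set (Cell 0)))) F → F.Nonempty →
    ∃ (j : ℕ) (Q : Cell j), convexHull ℝ (point '' (vertices Q : Set (Cell 0))) = F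
  /-- any two polytopes of the complex meet in a (possibly empty) face of each of them -/
  inter_face : ∀ {k l} (P : Cell k) (Q : Cell l),
    IsExposed ℝ (convexHull ℝ (point '' (vertices P : Set (Cell 0))))
      (convexHull ℝ (point '' (vertices P : Set (Cell 0))) ∩
        convexHull ℝ (point '' (vertices Q : Set (Cell 0))))
  /-- the incidence function `ε(P, Q)`, extended by zero to pairs where `Q` is no facet of `P` -/
  incidence : ∀ {k}, Cell (k + 1) → Cell k → ℤ
  incidence_facet : ∀ {k} (P : Cell (k + 1)) (Q : Cell k), vertices Q ⊆ vertices P →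
    incidence P Q = 1 ∨ incidence P Q = -1
  incidence_not_facet : ∀ {k} (P : Cell (k + 1)) (Q : Cell k), ¬ vertices Q ⊆ vertices P →
    incidence P Q = 0
  incidence_empty : ∀ P : Cell 1,
    letI := fintypeCell 0
    ∑ v : Cell 0, incidence P v = 0
  incidence_comp : ∀ {k} (P : Cell (k + 2)) (T : Cell k),
    letI := fintypeCell (k + 1)
    ∑ Q : Cell (k + 1), incidence P Q * incidence Q T = 0

attribute [instance] PolyhedralCellComplex.fintypeCell

/-- A labeled polyhedral cell complex: every vertex carries the exponent vector of a monomial in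
the variables indexed by `σ`. -/
structure LabeledCellComplex (N : ℕ) (σ : Type*) extends PolyhedralCellComplex N where
  /-- the exponent vector of the label of a vertex -/
  vertexLabel : Cell 0 → σ →₀ ℕ

namespace LabeledCellComplex

variable {N : ℕ} {σ : Type*} (X : LabeledCellComplex N σ) (K : Type*) [Field K]

/-- The label `a_P` of a cell: the exponent of the lcm of the labels of its vertices. -/
def label {k : ℕ} (P : X.Cell k) : σ →₀ ℕ :=
  (X.vertices P).sup X.vertexLabel

/-- The differential `R^{F_{k+1}(X)} → R^{F_k(X)}` of the cellular free complex,
`P ↦ ∑_Q ε(P, Q) x^{a_P - a_Q} Q`. -/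
def boundary (k : ℕ) :
    (X.Cell (k + 1) →₀ MvPolynomial σ K) →ₗ[MvPolynomial σ K] (X.Cell k →₀ MvPolynomial σ K) :=
  Finsupp.linearCombination (MvPolynomial σ K) fun P =>
    ∑ Q : X.Cell k, Finsupp.single Q (monomial (X.label P - X.label Q) (X.incidence P Q : K))

/-- The last differential `R^{F_0(X)} → R` of the cellular free complex, `v ↦ x^{a_v}`. -/
def augmentation : (X.Cell 0 →₀ MvPolynomial σ K) →ₗ[MvPolynomial σ K] MvPolynomial σ K :=
  Finsupp.linearCombination (MvPolynomial σ K) fun v => monomial (X.label v) (1 : K)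

end LabeledCellComplex

/-! ## Minimal free resolutions over a polynomial ring -/

section Resolution

variable {σ K : Type*} [Field K]

/-- The homogeneous maximal ideal, generated by all variables. -/
def irrelevantIdeal (σ K : Type*) [Field K] : Ideal (MvPolynomial σ K) :=
  Ideal.span (Set.range X)

/-- `⋯ → R^{B 2} → R^{B 1} → R^{B 0} → M → 0` is exact, and the matrices of the maps
`R^{B (k+1)} → R^{B k}` have all their entries in the homogeneous maximal ideal. -/
structure IsMinimalFreeResolution {B : ℕ → Type*} {M : Type*} [AddCommGroup M]
    [Module (MvPolynomial σ K) M]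
    (d : ∀ k, (B (k + 1) →₀ MvPolynomial σ K) →ₗ[MvPolynomial σ K] (B k →₀ MvPolynomial σ K))
    (π : (B 0 →₀ MvPolynomial σ K) →ₗ[MvPolynomial σ K] M) : Prop where
  surjective : Function.Surjective π
  exact_zero : Function.Exact (d 0) π
  exact_succ : ∀ k, Function.Exact (d (k + 1)) (d k)
  minimal : ∀ k P Q, d k (Finsupp.single P 1) Q ∈ irrelevantIdeal σ K

/-- When the basis element `P` of `R^{B k}` has degree `a k P`, the maps `d k` and `π` are
homogeneous of degree zero for the `ℕ^σ`-grading. -/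
def IsMultigraded {B : ℕ → Type*} (a : ∀ k, B k → σ →₀ ℕ)
    (d : ∀ k, (B (k + 1) →₀ MvPolynomial σ K) →ₗ[MvPolynomial σ K] (B k →₀ MvPolynomial σ K))
    (π : (B 0 →₀ MvPolynomial σ K) →ₗ[MvPolynomial σ K] MvPolynomial σ K) : Prop :=
  (∀ k P Q, ∀ b ∈ (d k (Finsupp.single P 1) Q).support, b + a k Q = a (k + 1) P) ∧
  ∀ v, ∀ b ∈ (π (Finsupp.single v 1)).support, b = a 0 v

end Resolution

/-! ## The planar cell complex of a set of cells of a tableau -/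

section Grid

variable {n : ℕ} (S : Set (Fin n × Fin n))

/-- The vertices: one vertex `(i, j)` for each element of `S`. -/
abbrev GridVertex : Type := {p : Fin n × Fin n // p ∈ S}

variable {S} in
/-- `v = (i, j)` and `w = (i + 1, j)`. -/
def Below (v w : GridVertex S) : Prop :=
  w.val.1.val = v.val.1.val + 1 ∧ w.val.2.val = v.val.2.val

variable {S} in
/-- `v = (i, j)` and `w = (i, j + 1)`. -/
def RightOf (v w : GridVertex S) : Prop :=
  w.val.1.val = v.val.1.val ∧ w.val.2.val = v.val.2.val + 1

/-- The edges, oriented: pairs `((i, j), (i + 1, j))` and `((i, j), (i, j + 1))` of vertices. -/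
abbrev GridEdge : Type := {e : GridVertex S × GridVertex S // Below e.1 e.2 ∨ RightOf e.1 e.2}

/-- The squares: quadruples `((i, j), (i + 1, j), (i + 1, j + 1), (i, j + 1))` of vertices. -/
structure GridSquare : Type where
  /-- the vertex `(i, j)` -/
  a : GridVertex S
  /-- the vertex `(i + 1, j)` -/
  b : GridVertex S
  /-- the vertex `(i + 1, j + 1)` -/
  c : GridVertex S
  /-- the vertex `(i, j + 1)` -/
  d : GridVertex S
  hab : Below a b
  hbc : RightOf b c
  had : RightOf a d
  hdc : Below d c

/-- The cells of dimension `k`. -/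
@[reducible]
def GridCell : ℕ → Type
  | 0 => GridVertex S
  | 1 => GridEdge S
  | 2 => GridSquare S
  | _ + 3 => Empty

variable {S}

theorem GridSquare.ext_vertices {s t : GridSquare S} (ha : s.a = t.a) (hb : s.b = t.b)
    (hc : s.c = t.c) (hd : s.d = t.d) : s = t := by
  cases s; cases t; simp_all

instance : Finite (GridSquare S) :=
  Finite.of_injective (fun s : GridSquare S => (s.a, s.b, s.c, s.d)) (by
    intro s t h
    simp only [Prod.mk.injEq] at h
    exact GridSquare.ext_vertices h.1 h.2.1 h.2.2.1 h.2.2.2)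

instance gridCellFinite : ∀ k, Finite (GridCell S k)
  | 0 => inferInstanceAs (Finite (GridVertex S))
  | 1 => inferInstanceAs (Finite (GridEdge S))
  | 2 => inferInstanceAs (Finite (GridSquare S))
  | _ + 3 => inferInstanceAs (Finite Empty)

/-- The vertices of a cell. -/
def gridVertices : ∀ {k}, GridCell S k → Finset (GridVertex S)
  | 0, v => {v}
  | 1, e => {e.val.1, e.val.2}
  | 2, s => {s.a, s.b, s.c, s.d}
  | _ + 3, s => s.elim

/-- The vertex `(i, j)` as a point of the plane. -/
def gridPoint (v : GridVertex S) : Fin 2 → ℝ := ![(v.val.1.val : ℝ), (v.val.2.val : ℝ)]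

/-- A boundary edge of a square. -/
def GridSquare.edgeAB (s : GridSquare S) : GridEdge S := ⟨(s.a, s.b), Or.inl s.hab⟩
/-- A boundary edge of a square. -/
def GridSquare.edgeBC (s : GridSquare S) : GridEdge S := ⟨(s.b, s.c), Or.inr s.hbc⟩
/-- A boundary edge of a square. -/
def GridSquare.edgeAD (s : GridSquare S) : GridEdge S := ⟨(s.a, s.d), Or.inr s.had⟩
/-- A boundary edge of a square. -/
def GridSquare.edgeDC (s : GridSquare S) : GridEdge S := ⟨(s.d, s.c), Or.inl s.hdc⟩

/-- The incidence of an edge and a vertex: the boundary of an edge is its first minus its second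
vertex. -/
def edgeIncidence (e : GridEdge S) (v : GridVertex S) : ℤ :=
  (if v = e.val.1 then 1 else 0) - (if v = e.val.2 then 1 else 0)

/-- The incidence of a square and an edge: the boundary of a square is `ad + dc - bc - ab`. -/
def squareIncidence (s : GridSquare S) (e : GridEdge S) : ℤ :=
  (if e = s.edgeAD then 1 else 0) + (if e = s.edgeDC then 1 else 0)
    - (if e = s.edgeBC then 1 else 0) - (if e = s.edgeAB then 1 else 0)

/-- The incidence function. -/
def gridIncidence : ∀ {k}, GridCell S (k + 1) → GridCell S k → ℤ
  | 0, e, v => edgeIncidence e v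
  | 1, s, e => squareIncidence s e
  | _ + 2, s, _ => s.elim

/-! ### The cells of a grid form a polyhedral cell complex -/

/-- The coordinates of a vertex. -/
def gridCoord (v : GridVertex S) : Fin 2 → ℕ := ![v.val.1.val, v.val.2.val]

theorem gridPoint_apply (v : GridVertex S) (i : Fin 2) : gridPoint v i = (gridCoord v i : ℝ) := by
  fin_cases i <;> rfl

theorem gridCoord_injective : Function.Injective (gridCoord : GridVertex S → Fin 2 → ℕ) := by
  intro v w h
  have h0 := congrFun h 0
  have h1 := congrFun h 1
  simp only [gridCoord, Matrix.cons_val_zero, Matrix.cons_val_one] at h0 h1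
  exact Subtype.ext (Prod.ext (Fin.ext h0) (Fin.ext h1))

theorem gridVertex_ext {v w : GridVertex S} (h0 : v.val.1.val = w.val.1.val)
    (h1 : v.val.2.val = w.val.2.val) : v = w :=
  Subtype.ext (Prod.ext (Fin.ext h0) (Fin.ext h1))

theorem gridPoint_injective : Function.Injective (gridPoint : GridVertex S → Fin 2 → ℝ) := by
  intro v w h
  apply gridCoord_injective
  funext i
  have := congrFun h i
  rw [gridPoint_apply, gridPoint_apply] at this
  exact_mod_cast this

/-- The polytope of a set of vertices. -/
abbrev gridHull (V : Finset (GridVertex S)) : Set (Fin 2 → ℝ) :=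
  convexHull ℝ (gridPoint '' (V : Set (GridVertex S)))

/-- The vertices in `V` are the corners of the box with corners `lo` and `hi`. -/
def IsGridBox (V : Finset (GridVertex S)) (lo hi : Fin 2 → ℕ) : Prop :=
  (∀ i, hi i = lo i ∨ hi i = lo i + 1) ∧
  (∀ v, v ∈ V ↔ ∀ i, gridCoord v i = lo i ∨ gridCoord v i = hi i) ∧
  ∀ c : Fin 2 → ℕ, (∀ i, c i = lo i ∨ c i = hi i) → ∃ v : GridVertex S, gridCoord v = c

theorem exists_isGridBox : ∀ {k} (P : GridCell S k), ∃ lo hi, IsGridBox (gridVertices P) lo hi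
  | 0, v => by
    let v' : GridVertex S := v
    refine ⟨gridCoord v', gridCoord v', fun i => Or.inl rfl, fun w => ?_, fun c hc =>
      ⟨v', funext fun i => ((or_self _).mp (hc i)).symm⟩⟩
    change w ∈ ({v'} : Finset (GridVertex S)) ↔ _
    simp only [Finset.mem_singleton, or_self]
    exact ⟨fun h i => by rw [h], fun h => gridCoord_injective (funext h)⟩
  | 1, e => by
    let e' : GridEdge S := e
    have key : ∀ w : GridVertex S, w ∈ gridVertices (k := 1) e ↔ w = e'.val.1 ∨ w = e'.val.2 := by
      intro w
      change w ∈ ({e'.val.1, e'.val.2} : Finset (GridVertex S)) ↔ _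
      simp
    obtain ⟨⟨v, w⟩, h⟩ := e'
    dsimp only at key h
    refine ⟨gridCoord v, gridCoord w, ?_, fun u => ?_, fun c hc => ?_⟩
    · intro i
      rcases h with ⟨h1, h2⟩ | ⟨h1, h2⟩ <;> fin_cases i <;> simp [gridCoord] <;> omega
    · rw [key]
      constructor
      · rintro (rfl | rfl) i
        · exact Or.inl rfl
        · exact Or.inr rfl
      · intro hu
        have h0 := hu 0
        have h1 := hu 1
        simp only [gridCoord, Matrix.cons_val_zero, Matrix.cons_val_one] at h0 h1
        rcases h with ⟨h2, h3⟩ | ⟨h2, h3⟩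
        · rcases h0 with h0 | h0
          · exact Or.inl (gridVertex_ext h0 (by omega))
          · exact Or.inr (gridVertex_ext h0 (by omega))
        · rcases h1 with h1 | h1
          · exact Or.inl (gridVertex_ext (by omega) h1)
          · exact Or.inr (gridVertex_ext (by omega) h1)
    · have h0 := hc 0
      have h1 := hc 1
      simp only [gridCoord, Matrix.cons_val_zero, Matrix.cons_val_one] at h0 h1
      have : gridCoord v = c ∨ gridCoord w = c := by
        rcases h with ⟨h2, h3⟩ | ⟨h2, h3⟩
        · rcases h0 with h0 | h0
          · left; funext i; fin_cases i <;> simp [gridCoord] <;> omega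
          · right; funext i; fin_cases i <;> simp [gridCoord] <;> omega
        · rcases h1 with h1 | h1
          · left; funext i; fin_cases i <;> simp [gridCoord] <;> omega
          · right; funext i; fin_cases i <;> simp [gridCoord] <;> omega
      rcases this with h | h
      · exact ⟨v, h⟩
      · exact ⟨w, h⟩
  | 2, s => by
    let s' : GridSquare S := s
    have key : ∀ w : GridVertex S, w ∈ gridVertices (k := 2) s ↔
        w = s'.a ∨ w = s'.b ∨ w = s'.c ∨ w = s'.d := by
      intro w
      change w ∈ ({s'.a, s'.b, s'.c, s'.d} : Finset (GridVertex S)) ↔ _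
      simp
    obtain ⟨a, b, c, d, ⟨h1, h2⟩, ⟨h3, h4⟩, ⟨h5, h6⟩, ⟨h7, h8⟩⟩ := s'
    dsimp only at key
    refine ⟨gridCoord a, gridCoord c, ?_, fun u => ?_, fun p hp => ?_⟩
    · intro i
      fin_cases i <;> simp [gridCoord] <;> omega
    · rw [key]
      constructor
      · rintro (rfl | rfl | rfl | rfl) i <;> fin_cases i <;> simp [gridCoord] <;> omega
      · intro hu
        have h0 := hu 0
        have h1 := hu 1
        simp only [gridCoord, Matrix.cons_val_zero, Matrix.cons_val_one] at h0 h1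
        rcases h0 with h0 | h0 <;> rcases h1 with h1 | h1
        · exact Or.inl (gridVertex_ext h0 h1)
        · exact Or.inr (Or.inr (Or.inr (gridVertex_ext (by omega) (by omega))))
        · exact Or.inr (Or.inl (gridVertex_ext (by omega) (by omega)))
        · exact Or.inr (Or.inr (Or.inl (gridVertex_ext h0 h1)))
    · have h0 := hp 0
      have h1 := hp 1
      simp only [gridCoord, Matrix.cons_val_zero, Matrix.cons_val_one] at h0 h1
      rcases h0 with h0 | h0 <;> rcases h1 with h1 | h1
      · refine ⟨a, ?_⟩; funext i; fin_cases i <;> simp [gridCoord] <;> omega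
      · refine ⟨d, ?_⟩; funext i; fin_cases i <;> simp [gridCoord] <;> omega
      · refine ⟨b, ?_⟩; funext i; fin_cases i <;> simp [gridCoord] <;> omega
      · refine ⟨c, ?_⟩; funext i; fin_cases i <;> simp [gridCoord] <;> omega
  | _ + 3, s => s.elim

/-- Every box of side lengths at most one with all corners in `S` is a cell. -/
theorem exists_cell_of_box {lo hi : Fin 2 → ℕ} (h : ∀ i, hi i = lo i ∨ hi i = lo i + 1)
    (hS : ∀ c : Fin 2 → ℕ, (∀ i, c i = lo i ∨ c i = hi i) → ∃ v : GridVertex S, gridCoord v = c) :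
    ∃ (k : ℕ) (P : GridCell S k), IsGridBox (gridVertices P) lo hi := by
  have fin : ∀ {k} (P : GridCell S k) , (∀ v, v ∈ gridVertices P ↔
      ∀ i, gridCoord v i = lo i ∨ gridCoord v i = hi i) →
      ∃ (k : ℕ) (P : GridCell S k), IsGridBox (gridVertices P) lo hi :=
    fun {k} P hP => ⟨k, P, h, hP, hS⟩
  obtain ⟨a, ha⟩ := hS ![lo 0, lo 1] (by intro i; fin_cases i <;> simp)
  obtain ⟨b, hb⟩ := hS ![hi 0, lo 1] (by intro i; fin_cases i <;> simp)
  obtain ⟨c, hc⟩ := hS ![hi 0, hi 1] (by intro i; fin_cases i <;> simp)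
  obtain ⟨d, hd⟩ := hS ![lo 0, hi 1] (by intro i; fin_cases i <;> simp)
  have a0 := congrFun ha 0
  have a1 := congrFun ha 1
  have b0 := congrFun hb 0
  have b1 := congrFun hb 1
  have c0 := congrFun hc 0
  have c1 := congrFun hc 1
  have d0 := congrFun hd 0
  have d1 := congrFun hd 1
  simp only [gridCoord, Matrix.cons_val_zero, Matrix.cons_val_one] at a0 a1 b0 b1 c0 c1 d0 d1
  have coord : ∀ v : GridVertex S, (∀ i, gridCoord v i = lo i ∨ gridCoord v i = hi i) ↔
      (v.val.1.val = lo 0 ∨ v.val.1.val = hi 0) ∧ (v.val.2.val = lo 1 ∨ v.val.2.val = hi 1) := by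
    intro v
    rw [Fin.forall_fin_two]
    simp [gridCoord]
  have ext : ∀ v w : GridVertex S, v = w ↔
      v.val.1.val = w.val.1.val ∧ v.val.2.val = w.val.2.val :=
    fun v w => ⟨fun h => by rw [h]; exact ⟨rfl, rfl⟩, fun h => gridVertex_ext h.1 h.2⟩
  rcases h 0 with h0 | h0 <;> rcases h 1 with h1 | h1
  · refine fin (k := 0) (show GridVertex S from a) fun v => ?_
    rw [coord]
    change v ∈ ({a} : Finset (GridVertex S)) ↔ _
    rw [Finset.mem_singleton, ext]
    omega
  · refine fin (k := 1) (show GridEdge S from ⟨(a, d), Or.inr (show RightOf a d from ⟨by omega, by omega⟩)⟩) fun v => ?_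
    rw [coord]
    change v ∈ ({a, d} : Finset (GridVertex S)) ↔ _
    rw [Finset.mem_insert, Finset.mem_singleton, ext, ext]
    omega
  · refine fin (k := 1) (show GridEdge S from ⟨(a, b), Or.inl (show Below a b from ⟨by omega, by omega⟩)⟩) fun v => ?_
    rw [coord]
    change v ∈ ({a, b} : Finset (GridVertex S)) ↔ _
    rw [Finset.mem_insert, Finset.mem_singleton, ext, ext]
    omega
  · refine fin (k := 2) (show GridSquare S from ⟨a, b, c, d, ⟨by omega, by omega⟩,
      ⟨by omega, by omega⟩, ⟨by omega, by omega⟩, ⟨by omega, by omega⟩⟩) fun v => ?_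
    rw [coord]
    change v ∈ ({a, b, c, d} : Finset (GridVertex S)) ↔ _
    rw [Finset.mem_insert, Finset.mem_insert, Finset.mem_insert, Finset.mem_singleton,
      ext, ext, ext, ext]
    omega

theorem IsGridBox.le {V : Finset (GridVertex S)} {lo hi : Fin 2 → ℕ} (h : IsGridBox V lo hi)
    (i : Fin 2) : lo i ≤ hi i := by
  have := h.1 i
  omega

theorem IsGridBox.hull_eq {V : Finset (GridVertex S)} {lo hi : Fin 2 → ℕ}
    (h : IsGridBox V lo hi) :
    gridHull V = Set.Icc (fun i => (lo i : ℝ)) (fun i => (hi i : ℝ)) := by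
  have hV : gridPoint '' (V : Set (GridVertex S)) =
      Set.univ.pi fun i => ({(lo i : ℝ), (hi i : ℝ)} : Set ℝ) := by
    ext x
    simp only [Set.mem_image, Finset.mem_coe, Set.mem_univ_pi, Set.mem_insert_iff,
      Set.mem_singleton_iff]
    constructor
    · rintro ⟨v, hv, rfl⟩ i
      rw [gridPoint_apply]
      exact_mod_cast (h.2.1 v).mp hv i
    · intro hx
      have : ∀ i, ∃ c : ℕ, (c : ℝ) = x i ∧ (c = lo i ∨ c = hi i) := by
        intro i
        rcases hx i with hi | hi
        · exact ⟨lo i, hi.symm, Or.inl rfl⟩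
        · exact ⟨_, hi.symm, Or.inr rfl⟩
      choose c hc hc' using this
      obtain ⟨v, hv⟩ := h.2.2 c hc'
      refine ⟨v, (h.2.1 v).mpr fun i => by rw [hv]; exact hc' i, ?_⟩
      funext i
      rw [gridPoint_apply, hv, hc]
  rw [gridHull, hV, convexHull_pi, ← Set.pi_univ_Icc]
  congr 1
  funext i
  rw [convexHull_pair, segment_eq_Icc (by exact_mod_cast h.le i)]

theorem isExposed_Icc_of_corners {p q p' q' : Fin 2 → ℝ}
    (h : ∀ i, (p' i = p i ∧ q' i = p i) ∨ (p' i = q i ∧ q' i = q i) ∨ (p' i = p i ∧ q' i = q i))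
    (hpq : p ≤ q) : IsExposed ℝ (Set.Icc p q) (Set.Icc p' q') := by
  have one : ∀ i, IsExposed ℝ (Set.Icc p q) {x | x ∈ Set.Icc p q ∧ p' i ≤ x i ∧ x i ≤ q' i} := by
    intro i
    rcases h i with ⟨h1, h2⟩ | ⟨h1, h2⟩ | ⟨h1, h2⟩ <;> rw [h1, h2]
    · intro _
      refine ⟨-ContinuousLinearMap.proj i, ?_⟩
      ext x
      simp only [Set.mem_ofPred_eq, neg_apply, ContinuousLinearMap.proj_apply,
        neg_le_neg_iff]
      exact ⟨fun hx => ⟨hx.1, fun y hy => hx.2.2.trans (hy.1 i)⟩,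
        fun hx => ⟨hx.1, hx.1.1 i, hx.2 p ⟨le_rfl, hpq⟩⟩⟩
    · intro _
      refine ⟨ContinuousLinearMap.proj i, ?_⟩
      ext x
      simp only [Set.mem_ofPred_eq, ContinuousLinearMap.proj_apply]
      exact ⟨fun hx => ⟨hx.1, fun y hy => (hy.2 i).trans hx.2.1⟩,
        fun hx => ⟨hx.1, hx.2 q ⟨hpq, le_rfl⟩, hx.1.2 i⟩⟩
    · have : {x | x ∈ Set.Icc p q ∧ p i ≤ x i ∧ x i ≤ q i} = Set.Icc p q := by
        ext x
        exact ⟨fun hx => hx.1, fun hx => ⟨hx, hx.1 i, hx.2 i⟩⟩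
      rw [this]
  have : Set.Icc p' q' = {x | x ∈ Set.Icc p q ∧ p' 0 ≤ x 0 ∧ x 0 ≤ q' 0} ∩
      {x | x ∈ Set.Icc p q ∧ p' 1 ≤ x 1 ∧ x 1 ≤ q' 1} := by
    ext x
    simp only [Set.mem_Icc, Pi.le_def, Fin.forall_fin_two, Set.mem_inter_iff, Set.mem_ofPred_eq]
    have h0 := h 0
    have h1 := h 1
    have := hpq 0
    have := hpq 1
    constructor
    · rintro ⟨⟨_, _⟩, _, _⟩
      have : p 0 ≤ x 0 ∧ x 0 ≤ q 0 := by
        rcases h0 with ⟨_, _⟩ | ⟨_, _⟩ | ⟨_, _⟩ <;> constructor <;> linarith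
      have : p 1 ≤ x 1 ∧ x 1 ≤ q 1 := by
        rcases h1 with ⟨_, _⟩ | ⟨_, _⟩ | ⟨_, _⟩ <;> constructor <;> linarith
      tauto
    · tauto
  rw [this]
  exact (one 0).inter (one 1)

theorem exists_Icc_of_isExposed {p q : Fin 2 → ℝ} (hpq : p ≤ q) {F : Set (Fin 2 → ℝ)}
    (hF : IsExposed ℝ (Set.Icc p q) F) (hne : F.Nonempty) :
    ∃ t : Fin 2 → Fin 3, F = Set.Icc (fun i => if t i = 1 then q i else p i)
      (fun i => if t i = 0 then p i else q i) := by
  obtain ⟨l, rfl⟩ := hF hne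
  set e : Fin 2 → ℝ := fun i => l (Pi.single i 1) with he
  have hl : ∀ x, l x = x 0 * e 0 + x 1 * e 1 := by
    intro x
    have : x = x 0 • Pi.single 0 1 + x 1 • Pi.single 1 1 := by
      funext i
      fin_cases i <;> simp
    conv_lhs => rw [this]
    simp [he]
  refine ⟨fun i => if e i < 0 then 0 else if 0 < e i then 1 else 2, ?_⟩
  ext x
  have key : ∀ i, ((if (if e i < 0 then (0 : Fin 3) else if 0 < e i then 1 else 2) = 1
      then q i else p i) ≤ x i ∧ x i ≤ (if (if e i < 0 then (0 : Fin 3) else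
      if 0 < e i then 1 else 2) = 0 then p i else q i)) ↔
      (p i ≤ x i ∧ x i ≤ q i) ∧ (∀ z, p i ≤ z → z ≤ q i → z * e i ≤ x i * e i) := by
    intro i
    have := hpq i
    rcases lt_trichotomy (e i) 0 with h | h | h
    · simp only [h, if_true]
      norm_num
      constructor
      · rintro ⟨h1, h2⟩
        exact ⟨⟨h1, by linarith⟩, fun z hz _ => by nlinarith⟩
      · rintro ⟨⟨h1, h2⟩, h3⟩
        refine ⟨h1, ?_⟩
        have := h3 (p i) le_rfl this
        nlinarith
    · simp [h]
    · simp only [h, not_lt_of_gt h, if_true, if_false]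
      norm_num
      constructor
      · rintro ⟨h1, h2⟩
        exact ⟨⟨by linarith, h2⟩, fun z _ hz => by nlinarith⟩
      · rintro ⟨⟨h1, h2⟩, h3⟩
        refine ⟨?_, h2⟩
        have := h3 (q i) this le_rfl
        nlinarith
  have hIcc : ∀ a b : Fin 2 → ℝ, x ∈ Set.Icc a b ↔ (a 0 ≤ x 0 ∧ x 0 ≤ b 0) ∧
      (a 1 ≤ x 1 ∧ x 1 ≤ b 1) := by
    intro a b
    simp only [Set.mem_Icc, Pi.le_def, Fin.forall_fin_two]
    tauto
  rw [hIcc]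
  dsimp only
  rw [key 0, key 1, Set.mem_ofPred_eq, hIcc]
  constructor
  · rintro ⟨⟨h0, h1⟩, h⟩
    refine ⟨⟨h0, fun z hz hz' => ?_⟩, ⟨h1, fun z hz hz' => ?_⟩⟩
    · have := h ![z, x 1] ⟨by
        intro i; fin_cases i
        · exact hz
        · exact h1.1, by
        intro i; fin_cases i
        · exact hz'
        · exact h1.2⟩
      rw [hl, hl] at this
      simpa using this
    · have := h ![x 0, z] ⟨by
        intro i; fin_cases i
        · exact h0.1
        · exact hz, by
        intro i; fin_cases i
        · exact h0.2
        · exact hz'⟩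
      rw [hl, hl] at this
      simpa using this
  · rintro ⟨⟨h0, h0'⟩, ⟨h1, h1'⟩⟩
    refine ⟨⟨h0, h1⟩, fun y hy => ?_⟩
    rw [hl, hl]
    exact add_le_add (h0' _ (hy.1 0) (hy.2 0)) (h1' _ (hy.1 1) (hy.2 1))

theorem grid_face_mem {k} (P : GridCell S k) (F : Set (Fin 2 → ℝ))
    (hF : IsExposed ℝ (gridHull (gridVertices P)) F) (hne : F.Nonempty) :
    ∃ (j : ℕ) (Q : GridCell S j), gridHull (gridVertices Q) = F := by
  obtain ⟨lo, hi, h⟩ := exists_isGridBox P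
  rw [h.hull_eq] at hF
  obtain ⟨t, rfl⟩ := exists_Icc_of_isExposed (fun i => Nat.cast_le.mpr (h.le i)) hF hne
  obtain ⟨j, Q, hQ⟩ := exists_cell_of_box (S := S) (lo := fun i => if t i = 1 then hi i else lo i)
    (hi := fun i => if t i = 0 then lo i else hi i) (by
      intro i
      have := h.1 i
      generalize t i = u
      fin_cases u <;> simp
      exact this) (by
      intro c hc
      apply h.2.2
      intro i
      have := hc i
      split_ifs at this <;> tauto)
  refine ⟨j, Q, ?_⟩
  rw [hQ.hull_eq]
  congr 1 <;> (funext i; split_ifs) <;> rfl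

theorem grid_inter_face {k l} (P : GridCell S k) (Q : GridCell S l) :
    IsExposed ℝ (gridHull (gridVertices P))
      (gridHull (gridVertices P) ∩ gridHull (gridVertices Q)) := by
  obtain ⟨lo, hi, h⟩ := exists_isGridBox P
  obtain ⟨lo', hi', h'⟩ := exists_isGridBox Q
  rw [h.hull_eq, h'.hull_eq, Set.Icc_inter_Icc]
  by_cases hle : ∀ i, max (lo i) (lo' i) ≤ min (hi i) (hi' i)
  · refine isExposed_Icc_of_corners (fun i => ?_) (fun i => Nat.cast_le.mpr (h.le i))
    have h1 := h.1 i
    have h2 := h'.1 i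
    have h3 := hle i
    simp only [Pi.sup_apply, Pi.inf_apply]
    norm_cast
    omega
  · have : Set.Icc ((fun i => (lo i : ℝ)) ⊔ fun i => (lo' i : ℝ))
        ((fun i => (hi i : ℝ)) ⊓ fun i => (hi' i : ℝ)) = ∅ := by
      apply Set.Icc_eq_empty
      intro hc
      apply hle
      intro i
      have := hc i
      simp only [Pi.sup_apply, Pi.inf_apply] at this
      exact_mod_cast this
    rw [this]
    exact isExposed_empty

theorem grid_dim_eq : ∀ {k} (P : GridCell S k),
    Module.finrank ℝ (vectorSpan ℝ (gridHull (gridVertices P))) = k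
  | 0, v => by
    rw [← direction_affineSpan, affineSpan_convexHull, direction_affineSpan]
    change Module.finrank ℝ (vectorSpan ℝ (gridPoint '' (({v} : Finset (GridVertex S)) :
      Set (GridVertex S)))) = 0
    have hv : ((({v} : Finset (GridVertex S)) : Set (GridVertex S))) = {v} := Finset.coe_singleton _
    rw [hv, Set.image_singleton, vectorSpan_singleton]
    simp
  | 1, e => by
    rw [← direction_affineSpan, affineSpan_convexHull, direction_affineSpan]
    let e' : GridEdge S := e
    change Module.finrank ℝ (vectorSpan ℝ (gridPoint '' (({e'.val.1, e'.val.2} :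
      Finset (GridVertex S)) : Set (GridVertex S)))) = 1
    rw [Finset.coe_pair, Set.image_pair, vectorSpan_pair]
    apply finrank_span_singleton
    rw [vsub_eq_sub, sub_ne_zero]
    intro h
    have h' := gridPoint_injective h
    have := e'.2
    rw [h'] at this
    rcases this with ⟨h1, h2⟩ | ⟨h1, h2⟩ <;> omega
  | 2, s => by
    rw [← direction_affineSpan, affineSpan_convexHull, direction_affineSpan]
    let s' : GridSquare S := s
    change Module.finrank ℝ (vectorSpan ℝ (gridPoint '' (({s'.a, s'.b, s'.c, s'.d} :
      Finset (GridVertex S)) : Set (GridVertex S)))) = 2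
    have mem : ∀ v w : GridVertex S, v ∈ ({s'.a, s'.b, s'.c, s'.d} : Finset (GridVertex S)) →
        w ∈ ({s'.a, s'.b, s'.c, s'.d} : Finset (GridVertex S)) → gridPoint w - gridPoint v ∈
        vectorSpan ℝ (gridPoint '' (({s'.a, s'.b, s'.c, s'.d} :
          Finset (GridVertex S)) : Set (GridVertex S))) := fun v w hv hw =>
      vsub_mem_vectorSpan ℝ (Set.mem_image_of_mem _ hw) (Set.mem_image_of_mem _ hv)
    have h0 := mem s'.a s'.b (by simp) (by simp)
    have h1 := mem s'.a s'.d (by simp) (by simp)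
    have e0 : gridPoint s'.b - gridPoint s'.a = ![1, 0] := by
      obtain ⟨h, h'⟩ := s'.hab
      funext i; fin_cases i <;> simp [gridPoint, h, h']
    have e1 : gridPoint s'.d - gridPoint s'.a = ![0, 1] := by
      obtain ⟨h, h'⟩ := s'.had
      funext i; fin_cases i <;> simp [gridPoint, h, h']
    rw [e0] at h0
    rw [e1] at h1
    have : vectorSpan ℝ (gridPoint '' (({s'.a, s'.b, s'.c, s'.d} :
          Finset (GridVertex S)) : Set (GridVertex S))) = ⊤ := by
      rw [eq_top_iff]
      intro x _
      have hx : x = x 0 • ![1, 0] + x 1 • ![0, 1] := by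
        funext i; fin_cases i <;> simp
      rw [hx]
      exact Submodule.add_mem _ (Submodule.smul_mem _ _ h0) (Submodule.smul_mem _ _ h1)
    rw [this]
    simp
  | _ + 3, s => s.elim

theorem gridVertices_nonempty : ∀ {k} (P : GridCell S k), (gridVertices P).Nonempty
  | 0, _ => Finset.singleton_nonempty _
  | 1, _ => Finset.insert_nonempty _ _
  | 2, _ => Finset.insert_nonempty _ _
  | _ + 3, s => s.elim

theorem gridEdge_ext {e f : GridEdge S} (h : ({e.val.1, e.val.2} : Finset (GridVertex S)) ⊆
    {f.val.1, f.val.2}) : e = f := by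
  obtain ⟨⟨a, b⟩, h1⟩ := e
  obtain ⟨⟨c, d⟩, h2⟩ := f
  simp only [Finset.insert_subset_iff, Finset.singleton_subset_iff, Finset.mem_insert,
    Finset.mem_singleton] at h
  dsimp only at h1 h2
  simp only [Below, RightOf] at h1 h2
  obtain ⟨rfl | rfl, rfl | rfl⟩ := h
  · omega
  · rfl
  · omega
  · omega

theorem gridVertices_injective : ∀ k, Function.Injective
    (gridVertices : GridCell S k → Finset (GridVertex S))
  | 0 => fun v w h => Finset.singleton_injective h
  | 1 => fun e f h => gridEdge_ext (S := S) (e := e) (f := f) (Finset.Subset.antisymm_iff.mp h).1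
  | 2 => fun s t h => by
    obtain ⟨a, b, c, d, ⟨h1, h2⟩, ⟨h3, h4⟩, ⟨h5, h6⟩, ⟨h7, h8⟩⟩ := (s : GridSquare S)
    obtain ⟨a', b', c', d', ⟨k1, k2⟩, ⟨k3, k4⟩, ⟨k5, k6⟩, ⟨k7, k8⟩⟩ := (t : GridSquare S)
    change ({a, b, c, d} : Finset (GridVertex S)) = {a', b', c', d'} at h
    have ha : a ∈ ({a', b', c', d'} : Finset (GridVertex S)) := by rw [← h]; simp
    have hc : c ∈ ({a', b', c', d'} : Finset (GridVertex S)) := by rw [← h]; simp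
    have ext : ∀ v w : GridVertex S, v = w ↔
        v.val.1.val = w.val.1.val ∧ v.val.2.val = w.val.2.val :=
      fun v w => ⟨fun h => by rw [h]; exact ⟨rfl, rfl⟩, fun h => gridVertex_ext h.1 h.2⟩
    simp only [Finset.mem_insert, Finset.mem_singleton, ext] at ha hc
    refine GridSquare.ext_vertices ?_ ?_ ?_ ?_ <;> dsimp only <;> rw [ext] <;> omega
  | _ + 3 => fun s => s.elim

theorem gridEdge_fst_ne_snd (e : GridEdge S) : e.val.1 ≠ e.val.2 := by
  intro h
  have := e.2
  rw [h] at this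
  rcases this with ⟨h1, h2⟩ | ⟨h1, h2⟩ <;> omega

theorem gridEdge_subset_square_iff (s : GridSquare S) (e : GridEdge S) :
    ({e.val.1, e.val.2} : Finset (GridVertex S)) ⊆ {s.a, s.b, s.c, s.d} ↔
      e = s.edgeAD ∨ e = s.edgeDC ∨ e = s.edgeBC ∨ e = s.edgeAB := by
  constructor
  · obtain ⟨⟨v, w⟩, h⟩ := e
    obtain ⟨a, b, c, d, ⟨h1, h2⟩, ⟨h3, h4⟩, ⟨h5, h6⟩, ⟨h7, h8⟩⟩ := s
    intro hs
    have hs' : (v = a ∨ v = b ∨ v = c ∨ v = d) ∧ (w = a ∨ w = b ∨ w = c ∨ w = d) := by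
      simpa only [Finset.insert_subset_iff, Finset.singleton_subset_iff, Finset.mem_insert,
        Finset.mem_singleton] using hs
    have h' := h
    simp only [Below, RightOf] at h'
    have : (v = a ∧ w = d) ∨ (v = d ∧ w = c) ∨ (v = b ∧ w = c) ∨ (v = a ∧ w = b) := by
      clear hs h
      rcases hs' with ⟨hv | hv | hv | hv, hw | hw | hw | hw⟩ <;> rw [hv, hw] at h' <;>
        first
        | exact Or.inl ⟨hv, hw⟩
        | exact Or.inr (Or.inl ⟨hv, hw⟩)
        | exact Or.inr (Or.inr (Or.inl ⟨hv, hw⟩))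
        | exact Or.inr (Or.inr (Or.inr ⟨hv, hw⟩))
        | (exfalso; omega)
    rcases this with ⟨rfl, rfl⟩ | ⟨rfl, rfl⟩ | ⟨rfl, rfl⟩ | ⟨rfl, rfl⟩
    · exact Or.inl rfl
    · exact Or.inr (Or.inl rfl)
    · exact Or.inr (Or.inr (Or.inl rfl))
    · exact Or.inr (Or.inr (Or.inr rfl))
  · rintro (rfl | rfl | rfl | rfl) <;>
      simp [GridSquare.edgeAD, GridSquare.edgeDC, GridSquare.edgeBC, GridSquare.edgeAB,
        Finset.insert_subset_iff]

theorem gridSquare_edges_ne (s : GridSquare S) :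
    s.edgeAD ≠ s.edgeDC ∧ s.edgeAD ≠ s.edgeBC ∧ s.edgeAD ≠ s.edgeAB ∧ s.edgeDC ≠ s.edgeBC ∧
      s.edgeDC ≠ s.edgeAB ∧ s.edgeBC ≠ s.edgeAB := by
  obtain ⟨h1, h2⟩ := s.hab
  obtain ⟨h3, h4⟩ := s.hbc
  obtain ⟨h5, h6⟩ := s.had
  obtain ⟨h7, h8⟩ := s.hdc
  refine ⟨?_, ?_, ?_, ?_, ?_, ?_⟩ <;> intro h <;>
  · have k1 := congrArg (fun e : GridEdge S => e.val.1.val.1.val) h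
    have k2 := congrArg (fun e : GridEdge S => e.val.1.val.2.val) h
    have k3 := congrArg (fun e : GridEdge S => e.val.2.val.1.val) h
    have k4 := congrArg (fun e : GridEdge S => e.val.2.val.2.val) h
    simp only [GridSquare.edgeAD, GridSquare.edgeDC, GridSquare.edgeBC, GridSquare.edgeAB]
      at k1 k2 k3 k4
    omega

theorem edgeIncidence_facet (e : GridEdge S) (v : GridVertex S)
    (h : ({v} : Finset (GridVertex S)) ⊆ {e.val.1, e.val.2}) :
    edgeIncidence e v = 1 ∨ edgeIncidence e v = -1 := by
  have hne := gridEdge_fst_ne_snd e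
  rw [Finset.singleton_subset_iff, Finset.mem_insert, Finset.mem_singleton] at h
  rw [edgeIncidence]
  rcases h with h | h <;> rw [h]
  · exact Or.inl (by rw [if_pos rfl, if_neg hne]; norm_num)
  · exact Or.inr (by rw [if_pos rfl, if_neg hne.symm]; norm_num)

theorem squareIncidence_facet (s : GridSquare S) (e : GridEdge S)
    (h : ({e.val.1, e.val.2} : Finset (GridVertex S)) ⊆ {s.a, s.b, s.c, s.d}) :
    squareIncidence s e = 1 ∨ squareIncidence s e = -1 := by
  obtain ⟨h1, h2, h3, h4, h5, h6⟩ := gridSquare_edges_ne s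
  rw [squareIncidence]
  rcases (gridEdge_subset_square_iff s e).mp h with h | h | h | h <;> rw [h]
  · exact Or.inl (by rw [if_pos rfl, if_neg h1, if_neg h2, if_neg h3]; norm_num)
  · exact Or.inl (by rw [if_pos rfl, if_neg h1.symm, if_neg h4, if_neg h5]; norm_num)
  · exact Or.inr (by rw [if_pos rfl, if_neg h2.symm, if_neg h4.symm, if_neg h6]; norm_num)
  · exact Or.inr (by
      rw [if_pos rfl, if_neg h3.symm, if_neg h5.symm, if_neg h6.symm]; norm_num)

theorem edgeIncidence_not_facet (e : GridEdge S) (v : GridVertex S)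
    (h : ¬ ({v} : Finset (GridVertex S)) ⊆ {e.val.1, e.val.2}) : edgeIncidence e v = 0 := by
  rw [Finset.singleton_subset_iff, Finset.mem_insert, Finset.mem_singleton, not_or] at h
  rw [edgeIncidence, if_neg h.1, if_neg h.2, sub_zero]

theorem squareIncidence_not_facet (s : GridSquare S) (e : GridEdge S)
    (h : ¬ ({e.val.1, e.val.2} : Finset (GridVertex S)) ⊆ {s.a, s.b, s.c, s.d}) :
    squareIncidence s e = 0 := by
  have h' := (gridEdge_subset_square_iff s e).not.mp h
  simp only [not_or] at h'
  rw [squareIncidence, if_neg h'.1, if_neg h'.2.1, if_neg h'.2.2.1, if_neg h'.2.2.2]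
  norm_num

theorem edgeIncidence_empty [Fintype (GridVertex S)] (e : GridEdge S) :
    ∑ v : GridVertex S, edgeIncidence e v = 0 := by
  simp only [edgeIncidence, Finset.sum_sub_distrib, Finset.sum_ite_eq', Finset.mem_univ,
    if_true, sub_self]

theorem squareIncidence_comp [Fintype (GridEdge S)] (s : GridSquare S) (v : GridVertex S) :
    ∑ e : GridEdge S, squareIncidence s e * edgeIncidence e v = 0 := by
  simp only [squareIncidence, sub_mul, add_mul, ite_mul, one_mul, zero_mul,
    Finset.sum_sub_distrib, Finset.sum_add_distrib, Finset.sum_ite_eq', Finset.mem_univ, if_true]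
  have key : ∀ p q r t : ℤ, p - q + (q - r) - (t - r) - (p - t) = 0 := by
    intros
    ring
  exact key (if v = s.a then 1 else 0) (if v = s.d then 1 else 0) (if v = s.c then 1 else 0)
    (if v = s.b then 1 else 0)

theorem gridIncidence_facet : ∀ {k} (P : GridCell S (k + 1)) (Q : GridCell S k),
    gridVertices Q ⊆ gridVertices P → gridIncidence P Q = 1 ∨ gridIncidence P Q = -1
  | 0, e, v => fun h => edgeIncidence_facet (S := S) e v h
  | 1, s, e => fun h => squareIncidence_facet (S := S) s e h
  | _ + 2, s, _ => s.elim

theorem gridIncidence_not_facet : ∀ {k} (P : GridCell S (k + 1)) (Q : GridCell S k),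
    ¬ gridVertices Q ⊆ gridVertices P → gridIncidence P Q = 0
  | 0, e, v => fun h => edgeIncidence_not_facet (S := S) e v h
  | 1, s, e => fun h => squareIncidence_not_facet (S := S) s e h
  | _ + 2, s, _ => s.elim

theorem gridIncidence_comp : ∀ {k} [Fintype (GridCell S (k + 1))] (P : GridCell S (k + 2))
    (T : GridCell S k), ∑ Q : GridCell S (k + 1), gridIncidence P Q * gridIncidence Q T = 0
  | 0, inst, s, v => @squareIncidence_comp _ S inst s v
  | _ + 1, _, s, _ => s.elim

variable (S) in
/-- The planar polyhedral cell complex of a set `S` of cells of a tableau: vertices are the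
elements of `S`, edges join horizontally or vertically adjacent ones, and the two-dimensional
cells are the unit squares all of whose corners are in `S`. -/
def gridComplex : PolyhedralCellComplex 2 where
  Cell := GridCell S
  fintypeCell := fun _ => Fintype.ofFinite _
  point := gridPoint (S := S)
  point_injective := gridPoint_injective (S := S)
  vertices := gridVertices
  vertices_nonempty := gridVertices_nonempty
  vertices_zero := fun _ => rfl
  vertices_injective := gridVertices_injective
  dim_eq := grid_dim_eq
  face_mem := grid_face_mem
  inter_face := grid_inter_face
  incidence := gridIncidence
  incidence_facet := gridIncidence_facet
  incidence_not_facet := gridIncidence_not_facet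
  incidence_empty := fun P => @edgeIncidence_empty _ S (Fintype.ofFinite _) P
  incidence_comp := fun P T => @gridIncidence_comp _ S _ (Fintype.ofFinite _) P T

end Grid

/-- The labeled planar cell complex of an ideal `I` generated in degree two. Its vertices are the
`v_{i,j}` with `i ≤ j` and `x_i x_j ∈ I`, and `v_{i,j}` is labeled by `m_I / (x_i x_j)`. -/
def tableauComplex {K : Type*} [Field K] {n : ℕ} (I : Ideal (MvPolynomial (Fin n) K)) :
    LabeledCellComplex 2 (Fin n) where
  toPolyhedralCellComplex :=
    gridComplex {p : Fin n × Fin n | p.1 ≤ p.2 ∧ (X p.1 * X p.2 : MvPolynomial (Fin n) K) ∈ I}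
  vertexLabel := fun (v : GridVertex _) =>
    lcmExponent I - (Finsupp.single v.val.1 1 + Finsupp.single v.val.2 1)

/-- The labeled planar cell complex `X_λ`. -/
abbrev ferrersComplex (K : Type*) [Field K] {m n : ℕ} (hmn : m ≤ n) (lam : Fin m → ℕ) :
    LabeledCellComplex 2 (Fin n) :=
  tableauComplex (specializedFerrersIdeal K hmn lam)

end LCMDual

end

open MvPolynomial

noncomputable section

namespace LCMDual

/-! The argument is a linear-quotients argument in which every step is made explicit by a cell.
Order the vertices `(i, j)` row by row, and rank an edge or a square by its last vertex. At each
homological level, take a cycle and look at its coefficients of top rank; these can be cancelled by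
the boundary of one-dimension-higher cells ending at the same vertex. Since ranks are natural
numbers and supports are finite, `le_of_filtration_step` turns such a cancellation into an inclusion
of the cycles in the boundaries.

Vertices: if `v = (i, j)` is the last vertex of a syzygy, its coefficient lies in the colon ideal of
the earlier labels by the label of `v`. That ideal is generated by `x_i` when there is a row above
and by `x_j` when `v` is off the diagonal (`exists_edge_of_label_le`). These variables are precisely
the ratios of labels along the vertical and the horizontal edge ending at `v`, so boundaries of
edges remove the coefficient (`exact_augmentation`).

Edges: if both edges end at `v`, the coefficient at `v` of the boundary is a relation between `x_i`
and `x_j` with `i ≠ j`, hence a multiple of the Koszul relation, which the square ending at `v`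
realizes. If only one edge ends at `v`, its coefficient is zero (`exact_boundary_zero`). Squares:
each is determined by its last vertex, so no cancellation is possible and the last map is injective
(`ker_boundary_one`).

What is used of the ideal is collected in `IsShiftedIdeal`: its cells form a shifted shape, and its
quadratic monomials divide `m_I`. For the specialized Ferrers ideal the lcm is `x_1⋯x_m ·
x_1⋯x_{λ_1}`, of degree `m + λ_1`. A vertex, edge or square label is `m_I` divided by a monomial of
degree 2, 1 or 0; this yields both the shifts and minimality. -/

/-- Elements of a free module that can be reduced, modulo a submodule, to elements supported in
strictly smaller filtration degree lie in that submodule. -/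
theorem le_of_filtration_step {R B : Type*} [CommRing R] (ρ : B → ℕ)
    (Z N : Submodule R (B →₀ R)) (hNZ : N ≤ Z)
    (step : ∀ k, ∀ x ∈ Z, (∀ b, x b ≠ 0 → ρ b ≤ k) →
      ∃ y ∈ N, ∀ b, (x - y) b ≠ 0 → ρ b < k) : Z ≤ N := by
  have key : ∀ k, ∀ x ∈ Z, (∀ b, x b ≠ 0 → ρ b < k) → x ∈ N := by
    intro k
    induction k with
    | zero =>
      intro x _ h
      have : x = 0 := by
        ext b
        by_contra hb
        exact absurd (h b hb) (Nat.not_lt_zero _)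
      rw [this]
      exact N.zero_mem
    | succ k ih =>
      intro x hx h
      obtain ⟨y, hy, hxy⟩ := step k x hx fun b hb => Nat.le_of_lt_succ (h b hb)
      have := N.add_mem (ih (x - y) (Z.sub_mem hx (hNZ hy)) hxy) hy
      rwa [sub_add_cancel] at this
  intro x hx
  refine key (x.support.sup ρ + 1) x hx fun b hb => Nat.lt_succ_of_le ?_
  exact Finset.le_sup (f := ρ) (Finsupp.mem_support_iff.mpr hb)

/-- If two monomial multiples by different variables cancel, then both come from a common
coefficient. -/
theorem exists_of_mul_X_eq_mul_X {σ R : Type*} [CommRing R] [IsDomain R]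
    {i j : σ} (hij : i ≠ j) {p q : MvPolynomial σ R} (h : p * X i = q * X j) :
    ∃ t, p = t * X j ∧ q = t * X i := by
  have hd : (X i : MvPolynomial σ R) ∣ q * X j := ⟨p, by rw [← h, mul_comm]⟩
  rcases X_prime.dvd_or_dvd hd with ⟨t, ht⟩ | hd'
  · refine ⟨t, ?_, by rw [ht, mul_comm]⟩
    refine mul_right_cancel₀ (X_ne_zero i) ?_
    rw [h, ht]
    ring
  · exact absurd (X_dvd_X.mp hd') hij

theorem monomial_mem_irrelevantIdeal {σ K : Type*} [Field K] {u : σ →₀ ℕ} (hu : u ≠ 0) (c : K) :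
    monomial u c ∈ irrelevantIdeal σ K := by
  obtain ⟨i, hi⟩ := Finsupp.ne_iff.mp hu
  rw [irrelevantIdeal, ← Set.image_univ, mem_ideal_span_X_image]
  intro w hw
  have : w = u := by
    have := support_monomial_subset hw
    simpa using this
  exact ⟨i, Set.mem_univ _, by rw [this]; exact hi⟩

/-! ### Cellular free complexes of arbitrary labeled cell complexes. -/

namespace LabeledCellComplex

variable {N : ℕ} {σ : Type*} (X : LabeledCellComplex N σ) (K : Type*) [Field K]

theorem boundary_apply {k : ℕ} (x : X.Cell (k + 1) →₀ MvPolynomial σ K) (Q : X.Cell k) :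
    X.boundary K k x Q =
      ∑ P, x P * monomial (X.label P - X.label Q) (X.incidence P Q : K) := by
  classical
  rw [boundary, Finsupp.linearCombination_apply, Finsupp.sum_fintype _ _ (by simp),
    Finsupp.finsetSum_apply]
  refine Finset.sum_congr rfl fun P _ => ?_
  rw [Finsupp.smul_apply, Finsupp.finsetSum_apply, smul_eq_mul]
  congr 1
  rw [Finset.sum_eq_single Q]
  · simp
  · intro Q' _ h
    simp [h]
  · simp

theorem boundary_single {k : ℕ} (P : X.Cell (k + 1)) (Q : X.Cell k) :
    X.boundary K k (Finsupp.single P 1) Q =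
      monomial (X.label P - X.label Q) (X.incidence P Q : K) := by
  classical
  rw [boundary_apply, Finset.sum_eq_single P]
  · simp
  · intro P' _ h
    simp [Finsupp.single_eq_of_ne h]
  · simp

theorem boundary_apply_eq_single {k : ℕ} (x : X.Cell (k + 1) →₀ MvPolynomial σ K) (Q : X.Cell k)
    (P : X.Cell (k + 1)) (h : ∀ P' ≠ P, x P' = 0 ∨ X.incidence P' Q = 0) :
    X.boundary K k x Q = x P * monomial (X.label P - X.label Q) (X.incidence P Q : K) := by
  rw [boundary_apply, Finset.sum_eq_single P]
  · intro P' _ hP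
    rcases h P' hP with h | h <;> simp [h]
  · simp

theorem boundary_apply_eq_add {k : ℕ} (x : X.Cell (k + 1) →₀ MvPolynomial σ K) (Q : X.Cell k)
    {P₁ P₂ : X.Cell (k + 1)} (hne : P₁ ≠ P₂)
    (h : ∀ P', P' ≠ P₁ → P' ≠ P₂ → x P' = 0 ∨ X.incidence P' Q = 0) :
    X.boundary K k x Q = x P₁ * monomial (X.label P₁ - X.label Q) (X.incidence P₁ Q : K) +
      x P₂ * monomial (X.label P₂ - X.label Q) (X.incidence P₂ Q : K) := by
  classical
  rw [boundary_apply, Finset.sum_eq_add P₁ P₂ hne]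
  · intro P' _ hP
    rcases h P' hP.1 hP.2 with h | h <;> simp [h]
  · simp
  · simp

theorem augmentation_apply (x : X.Cell 0 →₀ MvPolynomial σ K) :
    X.augmentation K x = ∑ v, x v * monomial (X.label v) (1 : K) := by
  rw [augmentation, Finsupp.linearCombination_apply, Finsupp.sum_fintype _ _ (by simp)]
  rfl

theorem augmentation_single (v : X.Cell 0) :
    X.augmentation K (Finsupp.single v 1) = monomial (X.label v) (1 : K) := by
  simp [augmentation]

theorem label_zero (v : X.Cell 0) : X.label v = X.vertexLabel v := by
  rw [label, X.vertices_zero, Finset.sup_singleton]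

theorem label_mono {k l : ℕ} {P : X.Cell k} {Q : X.Cell l} (h : X.vertices Q ⊆ X.vertices P) :
    X.label Q ≤ X.label P :=
  Finset.sup_mono h

/-- A nonzero incidence forces a facet, so truncated subtraction of exponents is a genuine quotient
of monomials wherever an entry of the differential can be nonzero. -/
theorem label_le_of_incidence_ne_zero {k : ℕ} {P : X.Cell (k + 1)} {Q : X.Cell k}
    (h : X.incidence P Q ≠ 0) : X.label Q ≤ X.label P := by
  by_contra hl
  exact h (X.incidence_not_facet P Q fun hs => hl (X.label_mono hs))

/-- Along `P`, `Q`, `T` the label ratios telescope to a monomial that does not depend on `Q`. Each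
entry of the composite is therefore this monomial times the integer sum that vanishes for any
incidence function. -/
theorem boundary_comp_boundary (k : ℕ) (x : X.Cell (k + 2) →₀ MvPolynomial σ K) :
    X.boundary K k (X.boundary K (k + 1) x) = 0 := by
  classical
  suffices h : X.boundary K k ∘ₗ X.boundary K (k + 1) = 0 from LinearMap.congr_fun h x
  refine Finsupp.lhom_ext' fun P => LinearMap.ext_ring ?_
  ext1 T
  simp only [LinearMap.comp_apply, Finsupp.lsingle_apply, LinearMap.zero_apply,
    Finsupp.zero_apply]
  rw [boundary_apply]
  simp only [boundary_single, monomial_mul]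
  have key : ∀ Q : X.Cell (k + 1),
      monomial (X.label P - X.label Q + (X.label Q - X.label T))
        ((X.incidence P Q : K) * (X.incidence Q T : K)) =
      monomial (X.label P - X.label T) ((X.incidence P Q * X.incidence Q T : ℤ) : K) := by
    intro Q
    rw [Int.cast_mul]
    by_cases h1 : X.incidence P Q = 0
    · simp [h1]
    by_cases h2 : X.incidence Q T = 0
    · simp [h2]
    rw [tsub_add_tsub_cancel (X.label_le_of_incidence_ne_zero h1)
      (X.label_le_of_incidence_ne_zero h2)]
  rw [Finset.sum_congr rfl fun Q _ => key Q, ← map_sum, ← Int.cast_sum, X.incidence_comp]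
  simp

/-- The same telescoping one step lower: the image of an edge is its label times the sum of its
incidences, which is zero. -/
theorem augmentation_comp_boundary (x : X.Cell 1 →₀ MvPolynomial σ K) :
    X.augmentation K (X.boundary K 0 x) = 0 := by
  classical
  suffices h : X.augmentation K ∘ₗ X.boundary K 0 = 0 from LinearMap.congr_fun h x
  refine Finsupp.lhom_ext' fun P => LinearMap.ext_ring ?_
  simp only [LinearMap.comp_apply, Finsupp.lsingle_apply, LinearMap.zero_apply]
  rw [augmentation_apply]
  simp only [boundary_single, monomial_mul]
  have key : ∀ v : X.Cell 0,
      monomial (X.label P - X.label v + X.label v) ((X.incidence P v : K) * 1) =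
      monomial (X.label P) ((X.incidence P v : ℤ) : K) := by
    intro v
    rw [mul_one]
    by_cases h1 : X.incidence P v = 0
    · simp [h1]
    rw [tsub_add_cancel_of_le (X.label_le_of_incidence_ne_zero h1)]
  rw [Finset.sum_congr rfl fun Q _ => key Q, ← map_sum, ← Int.cast_sum, X.incidence_empty]
  simp

theorem isMultigraded :
    IsMultigraded (fun k (P : X.Cell k) => X.label P) (X.boundary K) (X.augmentation K) := by
  refine ⟨fun k P Q b hb => ?_, fun v b hb => ?_⟩
  · rw [boundary_single] at hb
    have hb' : b = X.label P - X.label Q := by simpa using support_monomial_subset hb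
    have hne : X.incidence P Q ≠ 0 := by
      intro h
      rw [h] at hb
      simp at hb
    rw [hb', tsub_add_cancel_of_le (X.label_le_of_incidence_ne_zero hne)]
  · rw [augmentation_single] at hb
    simpa using support_monomial_subset hb

theorem boundary_single_mem_irrelevantIdeal {k : ℕ} (P : X.Cell (k + 1)) (Q : X.Cell k)
    (h : (X.label Q).degree < (X.label P).degree) :
    X.boundary K k (Finsupp.single P 1) Q ∈ irrelevantIdeal σ K := by
  rw [boundary_single]
  refine monomial_mem_irrelevantIdeal (fun h0 => ?_) _
  rw [tsub_eq_zero_iff_le] at h0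
  exact absurd (Finsupp.degree_mono h0) (not_le.mpr h)

theorem range_augmentation :
    LinearMap.range (X.augmentation K) =
      Ideal.span ((fun u => monomial u (1 : K)) '' Set.range fun v : X.Cell 0 => X.label v) := by
  rw [augmentation, Finsupp.range_linearCombination, ← Set.range_comp]
  rfl

end LabeledCellComplex

/-! ### Combinatorics of shifted shapes and their last vertices. -/

section Shape

variable {n : ℕ}

/-- The position of a vertex in the row-by-row order. -/
def lexRank {S : Set (Fin n × Fin n)} (v : GridVertex S) : ℕ := v.val.1.val * n + v.val.2.val

/-- Columns are smaller than `n`, so row and column are the two digits of the rank in base `n`. -/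
theorem lexRank_lt_iff {S : Set (Fin n × Fin n)} {v w : GridVertex S} :
    lexRank v < lexRank w ↔ v.val.1.val < w.val.1.val ∨
      (v.val.1.val = w.val.1.val ∧ v.val.2.val < w.val.2.val) := by
  have hv := v.val.2.isLt
  have hw := w.val.2.isLt
  simp only [lexRank]
  rcases lt_trichotomy v.val.1.val w.val.1.val with h | h | h
  · have := Nat.mul_le_mul_right n h
    rw [Nat.succ_mul] at this
    omega
  · rw [h]; omega
  · have := Nat.mul_le_mul_right n h
    rw [Nat.succ_mul] at this
    omega

theorem lexRank_injective {S : Set (Fin n × Fin n)} :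
    Function.Injective (lexRank : GridVertex S → ℕ) := by
  intro v w h
  have h1 : ¬ lexRank v < lexRank w := by omega
  have h2 : ¬ lexRank w < lexRank v := by omega
  rw [lexRank_lt_iff] at h1 h2
  exact gridVertex_ext (by omega) (by omega)

theorem lexRank_lt_of_edge {S : Set (Fin n × Fin n)} {v w : GridVertex S}
    (h : Below v w ∨ RightOf v w) : lexRank v < lexRank w := by
  rw [lexRank_lt_iff]
  simp only [Below, RightOf] at h
  omega

/-- A set of cells on and above the diagonal, closed under moving up, and under moving left as
long as the diagonal is not passed. -/
structure IsShiftedShape (S : Set (Fin n × Fin n)) : Prop where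
  le : ∀ p ∈ S, p.1 ≤ p.2
  up : ∀ i j, (i, j) ∈ S → ∀ i' ≤ i, (i', j) ∈ S
  left : ∀ i j, (i, j) ∈ S → ∀ j' ≤ j, i ≤ j' → (i, j') ∈ S

variable {S : Set (Fin n × Fin n)}

theorem IsShiftedShape.exists_below (hS : IsShiftedShape S) (v : GridVertex S)
    (h : 0 < v.val.1.val) : ∃ w : GridVertex S, Below w v := by
  obtain ⟨⟨i, j⟩, hv⟩ := v
  refine ⟨⟨(⟨i.val - 1, by omega⟩, j), hS.up i j hv _ (Fin.le_def.mpr (Nat.sub_le _ _))⟩, ?_, rfl⟩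
  simp only at h ⊢
  omega

theorem IsShiftedShape.exists_rightOf (hS : IsShiftedShape S) (v : GridVertex S)
    (h : v.val.1.val < v.val.2.val) : ∃ w : GridVertex S, RightOf w v := by
  obtain ⟨⟨i, j⟩, hv⟩ := v
  simp only at h
  refine ⟨⟨(i, ⟨j.val - 1, by omega⟩), hS.left i j hv _ (Fin.le_def.mpr (Nat.sub_le _ _))
    (Fin.le_def.mpr (by simp only; omega))⟩, rfl, ?_⟩
  simp only
  omega

/-- The two edges ending at `v` always span a square. Since `u` is on or above the diagonal, the
vertex `w` above `v` is strictly above it, so `w` has a left neighbour, which is the missing corner.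
-/
theorem IsShiftedShape.exists_square (hS : IsShiftedShape S) {v w u : GridVertex S}
    (hd : Below w v) (hb : RightOf u v) : ∃ s : GridSquare S, s.c = v ∧ s.d = w ∧ s.b = u := by
  have hle := Fin.le_def.mp (hS.le _ u.2)
  obtain ⟨h1, h2⟩ := hd
  obtain ⟨h3, h4⟩ := hb
  obtain ⟨a, h5, h6⟩ := hS.exists_rightOf w (by omega)
  exact ⟨⟨a, u, v, w, ⟨by omega, by omega⟩, ⟨h3, h4⟩, ⟨h5, h6⟩, ⟨h1, h2⟩⟩, rfl, rfl, rfl⟩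

/-- With `lexRank_injective`, this puts at most one square in each rank. -/
theorem GridSquare.eq_of_c_eq {s t : GridSquare S} (h : s.c = t.c) : s = t := by
  obtain ⟨a, b, c, d, ⟨h1, h2⟩, ⟨h3, h4⟩, ⟨h5, h6⟩, ⟨h7, h8⟩⟩ := s
  obtain ⟨a', b', c', d', ⟨h1', h2'⟩, ⟨h3', h4'⟩, ⟨h5', h6'⟩, ⟨h7', h8'⟩⟩ := t
  simp only at h
  subst h
  refine GridSquare.ext_vertices ?_ ?_ ?_ ?_ <;> apply gridVertex_ext <;> simp only <;> omega

theorem GridEdge.eq_of_below {e f : GridEdge S} (he : Below e.val.1 e.val.2)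
    (hf : Below f.val.1 f.val.2) (h : e.val.2 = f.val.2) : e = f := by
  refine Subtype.ext (Prod.ext ?_ h)
  have := he.1; have := he.2; have := hf.1; have := hf.2
  rw [h] at *
  exact gridVertex_ext (by omega) (by omega)

theorem GridEdge.eq_of_rightOf {e f : GridEdge S} (he : RightOf e.val.1 e.val.2)
    (hf : RightOf f.val.1 f.val.2) (h : e.val.2 = f.val.2) : e = f := by
  refine Subtype.ext (Prod.ext ?_ h)
  have := he.1; have := he.2; have := hf.1; have := hf.2
  rw [h] at *
  exact gridVertex_ext (by omega) (by omega)

theorem edgeIncidence_snd (e : GridEdge S) : edgeIncidence e e.val.2 = -1 := by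
  rw [edgeIncidence, if_pos rfl, if_neg (gridEdge_fst_ne_snd e).symm]; norm_num

theorem eq_or_eq_of_edgeIncidence_ne_zero {e : GridEdge S} {v : GridVertex S}
    (h : edgeIncidence e v ≠ 0) : v = e.val.1 ∨ v = e.val.2 := by
  by_contra hn
  rw [not_or] at hn
  exact h (by rw [edgeIncidence, if_neg hn.1, if_neg hn.2, sub_zero])

theorem squareIncidence_edgeDC (s : GridSquare S) : squareIncidence s s.edgeDC = 1 := by
  obtain ⟨h1, h2, h3, h4, h5, h6⟩ := gridSquare_edges_ne s
  rw [squareIncidence, if_pos rfl, if_neg h1.symm, if_neg h4, if_neg h5]; norm_num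

theorem squareIncidence_edgeBC (s : GridSquare S) : squareIncidence s s.edgeBC = -1 := by
  obtain ⟨h1, h2, h3, h4, h5, h6⟩ := gridSquare_edges_ne s
  rw [squareIncidence, if_pos rfl, if_neg h2.symm, if_neg h4.symm, if_neg h6]; norm_num

theorem eq_edge_of_squareIncidence_ne_zero {s : GridSquare S} {e : GridEdge S}
    (h : squareIncidence s e ≠ 0) :
    e = s.edgeAD ∨ e = s.edgeDC ∨ e = s.edgeBC ∨ e = s.edgeAB := by
  by_contra hn
  simp only [not_or] at hn
  exact h (by
    rw [squareIncidence, if_neg hn.1, if_neg hn.2.1, if_neg hn.2.2.1, if_neg hn.2.2.2]; norm_num)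

theorem lexRank_snd_le_of_squareIncidence_ne_zero {s : GridSquare S} {e : GridEdge S}
    (h : squareIncidence s e ≠ 0) : lexRank e.val.2 ≤ lexRank s.c := by
  have h1 := lexRank_lt_of_edge (Or.inr s.hbc)
  have h2 := lexRank_lt_of_edge (Or.inl s.hdc)
  rcases eq_edge_of_squareIncidence_ne_zero h with rfl | rfl | rfl | rfl
  exacts [h2.le, le_rfl, le_rfl, h1.le]

end Shape

/-! ### Labels of edges and squares of a tableau complex. -/

section Tableau

variable {K : Type*} [Field K] {n : ℕ} (I : Ideal (MvPolynomial (Fin n) K))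

/-- The vertex set of the tableau complex of an ideal. -/
abbrev tableauCells : Set (Fin n × Fin n) :=
  {p : Fin n × Fin n | p.1 ≤ p.2 ∧ (X p.1 * X p.2 : MvPolynomial (Fin n) K) ∈ I}

variable {I}

theorem tableau_label_vertex (v : GridVertex (tableauCells I)) :
    (tableauComplex I).label (k := 0) v =
      lcmExponent I - (Finsupp.single v.val.1 1 + Finsupp.single v.val.2 1) :=
  (tableauComplex I).label_zero v

theorem tableau_label_edge (e : GridEdge (tableauCells I)) :
    (tableauComplex I).label (k := 1) e =
      (tableauComplex I).label (k := 0) e.val.1 ⊔ (tableauComplex I).label (k := 0) e.val.2 := by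
  rw [tableau_label_vertex, tableau_label_vertex]
  change ({e.val.1, e.val.2} : Finset (GridVertex (tableauCells I))).sup
    (fun v => lcmExponent I - (Finsupp.single v.val.1 1 + Finsupp.single v.val.2 1)) = _
  rw [Finset.sup_insert, Finset.sup_singleton]

theorem tableau_label_square_eq_sup (s : GridSquare (tableauCells I)) :
    (tableauComplex I).label (k := 2) s =
      (tableauComplex I).label (k := 0) s.a ⊔ ((tableauComplex I).label (k := 0) s.b ⊔
        ((tableauComplex I).label (k := 0) s.c ⊔ (tableauComplex I).label (k := 0) s.d)) := by
  simp only [tableau_label_vertex]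
  change ({s.a, s.b, s.c, s.d} : Finset (GridVertex (tableauCells I))).sup
    (fun v => lcmExponent I - (Finsupp.single v.val.1 1 + Finsupp.single v.val.2 1)) = _
  rw [Finset.sup_insert, Finset.sup_insert, Finset.sup_insert, Finset.sup_singleton]

/-- The endpoints share the column variable and have different row variables, so the lcm of
`m_I/(x_i x_j)` and `m_I/(x_{i+1} x_j)` loses only the column variable. -/
theorem tableau_label_below {e : GridEdge (tableauCells I)} (h : Below e.val.1 e.val.2) :
    (tableauComplex I).label (k := 1) e = lcmExponent I - Finsupp.single e.val.2.val.2 1 := by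
  obtain ⟨h1, h2⟩ := h
  rw [tableau_label_edge, tableau_label_vertex, tableau_label_vertex]
  ext k
  simp only [Finsupp.sup_apply, Finsupp.tsub_apply, Finsupp.add_apply, Finsupp.single_apply,
    Fin.ext_iff, h1, h2]
  split_ifs <;> omega

theorem tableau_label_rightOf {e : GridEdge (tableauCells I)} (h : RightOf e.val.1 e.val.2) :
    (tableauComplex I).label (k := 1) e = lcmExponent I - Finsupp.single e.val.2.val.1 1 := by
  obtain ⟨h1, h2⟩ := h
  rw [tableau_label_edge, tableau_label_vertex, tableau_label_vertex]
  ext k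
  simp only [Finsupp.sup_apply, Finsupp.tsub_apply, Finsupp.add_apply, Finsupp.single_apply,
    Fin.ext_iff, h1, h2]
  split_ifs <;> omega

/-- Each variable is missing from the quadratic monomial of some corner, so the lcm recovers the
full exponent. When `j = i + 1` the variable of index `i + 1` occurs at both `(i, j)` and `(i + 1, j
+ 1)`, but not at `(i, j + 1)`. -/
theorem tableau_label_square (s : GridSquare (tableauCells I)) :
    (tableauComplex I).label (k := 2) s = lcmExponent I := by
  rw [tableau_label_square_eq_sup]
  simp only [tableau_label_vertex]
  obtain ⟨h1, h2⟩ := s.hab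
  obtain ⟨h3, h4⟩ := s.hbc
  obtain ⟨h5, h6⟩ := s.had
  have h7 := Fin.le_def.mp s.b.2.1
  ext k
  simp only [Finsupp.sup_apply, Finsupp.tsub_apply, Finsupp.add_apply, Finsupp.single_apply,
    Fin.ext_iff, h1, h2, h3, h4, h5, h6]
  split_ifs <;> omega

end Tableau

/-! ### Exactness and degrees for shifted ideals. -/

section Exactness

variable {K : Type*} [Field K] {n : ℕ} {I : Ideal (MvPolynomial (Fin n) K)}

/-- The quadratic monomials of `I` form a shifted shape, and divide `m_I`. -/
structure IsShiftedIdeal (I : Ideal (MvPolynomial (Fin n) K)) : Prop where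
  shape : IsShiftedShape (tableauCells I)
  le_lcm : ∀ v : GridVertex (tableauCells I),
    Finsupp.single v.val.1 1 + Finsupp.single v.val.2 1 ≤ lcmExponent I

/-- The rank of a vertex of the tableau complex. -/
def vertexRank (v : (tableauComplex I).Cell 0) : ℕ := lexRank (S := tableauCells I) v

/-- The rank of an edge of the tableau complex: the rank of its last vertex. -/
def edgeRank (e : (tableauComplex I).Cell 1) : ℕ :=
  lexRank (Subtype.val (α := GridVertex (tableauCells I) × GridVertex (tableauCells I)) e).2

/-- The rank of a square of the tableau complex: the rank of its last vertex. -/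
def squareRank (s : (tableauComplex I).Cell 2) : ℕ :=
  lexRank (GridSquare.c (S := tableauCells I) s)

namespace IsShiftedIdeal

/-- The edge keeps the column variable divided out, so passing from the vertex to the edge restores
the row variable. `le_lcm` ensures that this variable was really removed and not truncated away. -/
theorem label_below_sub (hI : IsShiftedIdeal I) {e : GridEdge (tableauCells I)}
    (h : Below e.val.1 e.val.2) :
    (tableauComplex I).label (k := 1) e - (tableauComplex I).label (k := 0) e.val.2 =
      Finsupp.single e.val.2.val.1 1 := by
  rw [tableau_label_below h, tableau_label_vertex]
  ext k
  have := hI.le_lcm e.val.2 k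
  simp only [Finsupp.tsub_apply, Finsupp.add_apply] at this ⊢
  omega

theorem label_rightOf_sub (hI : IsShiftedIdeal I) {e : GridEdge (tableauCells I)}
    (h : RightOf e.val.1 e.val.2) :
    (tableauComplex I).label (k := 1) e - (tableauComplex I).label (k := 0) e.val.2 =
      Finsupp.single e.val.2.val.2 1 := by
  rw [tableau_label_rightOf h, tableau_label_vertex]
  ext k
  have := hI.le_lcm e.val.2 k
  simp only [Finsupp.tsub_apply, Finsupp.add_apply] at this ⊢
  omega

theorem label_square_sub_edgeDC (hI : IsShiftedIdeal I) (s : GridSquare (tableauCells I)) :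
    (tableauComplex I).label (k := 2) s - (tableauComplex I).label (k := 1) s.edgeDC =
      Finsupp.single s.c.val.2 1 := by
  rw [tableau_label_square, tableau_label_below (e := s.edgeDC) s.hdc]
  ext k
  have := hI.le_lcm s.c k
  simp only [GridSquare.edgeDC, Finsupp.tsub_apply, Finsupp.add_apply] at this ⊢
  omega

theorem label_square_sub_edgeBC (hI : IsShiftedIdeal I) (s : GridSquare (tableauCells I)) :
    (tableauComplex I).label (k := 2) s - (tableauComplex I).label (k := 1) s.edgeBC =
      Finsupp.single s.c.val.1 1 := by
  rw [tableau_label_square, tableau_label_rightOf (e := s.edgeBC) s.hbc]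
  ext k
  have := hI.le_lcm s.c k
  simp only [GridSquare.edgeBC, Finsupp.tsub_apply, Finsupp.add_apply] at this ⊢
  omega

/-- The colon ideals of the labels, in the order of the vertices, are generated by the variables
that belong to the edges with the same second vertex. -/
theorem exists_edge_of_label_le (hI : IsShiftedIdeal I) {v w : GridVertex (tableauCells I)}
    (hwv : lexRank w < lexRank v) {u : Fin n →₀ ℕ}
    (h : (tableauComplex I).label (k := 0) w ≤ u + (tableauComplex I).label (k := 0) v) :
    ∃ e : GridEdge (tableauCells I), e.val.2 = v ∧
      (tableauComplex I).label (k := 1) e - (tableauComplex I).label (k := 0) v ≤ u := by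
  -- Cancelling `m_I` turns the hypothesis on labels into a divisibility: the monomial of `v`
  -- divides `x^u` times the monomial of `w`.
  have hu : ∀ k, (Finsupp.single v.val.1 1 + Finsupp.single v.val.2 1 : Fin n →₀ ℕ) k ≤
      u k + (Finsupp.single w.val.1 1 + Finsupp.single w.val.2 1 : Fin n →₀ ℕ) k := by
    intro k
    have h1 := hI.le_lcm v k
    have h2 := hI.le_lcm w k
    have h3 := h k
    rw [tableau_label_vertex, tableau_label_vertex, Finsupp.add_apply, Finsupp.tsub_apply,
      Finsupp.tsub_apply] at h3
    omega
  have hv := Fin.le_def.mp v.2.1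
  have hw := Fin.le_def.mp w.2.1
  have h1 := hu v.val.1
  have h2 := hu v.val.2
  rw [lexRank_lt_iff] at hwv
  simp only [Finsupp.add_apply, Finsupp.single_apply, Fin.ext_iff, if_true] at h1 h2
  -- Write `v = (i, j)` and `w = (i', j')`. On the diagonal, `w` lies in an earlier row and supplies
  -- at most one of the two factors `x_i`. Off the diagonal, `x_j` must come from `u` unless `j' =
  -- j`; then `i' < i < j`, so `w` does not supply `x_i` and `u` must.
  have hcase : (0 < v.val.1.val ∧ 1 ≤ u v.val.1) ∨
      (v.val.1.val < v.val.2.val ∧ 1 ≤ u v.val.2) := by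
    by_cases hd : v.val.1 = v.val.2
    · rw [← hd] at h2 hwv hv
      left
      split_ifs at h1 h2 <;> omega
    · have hd' := Fin.val_ne_of_ne hd
      split_ifs at h1 h2 <;> omega
  have hle : ∀ i : Fin n, 1 ≤ u i → Finsupp.single i 1 ≤ u := fun i hi => by
    rwa [Finsupp.single_le_iff]
  rcases hcase with ⟨h0, h1⟩ | ⟨h0, h1⟩
  · obtain ⟨w, hw⟩ := hI.shape.exists_below v h0
    refine ⟨⟨(w, v), Or.inl hw⟩, rfl, ?_⟩
    rw [hI.label_below_sub (e := ⟨(w, v), Or.inl hw⟩) hw]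
    exact hle _ h1
  · obtain ⟨w, hw⟩ := hI.shape.exists_rightOf v h0
    refine ⟨⟨(w, v), Or.inr hw⟩, rfl, ?_⟩
    rw [hI.label_rightOf_sub (e := ⟨(w, v), Or.inr hw⟩) hw]
    exact hle _ h1

/-- The syzygy expresses `x v` times the label of `v` through labels of earlier vertices, so `x v`
lies in a colon ideal of monomial ideals. Membership can be tested on each monomial of `x v`, where
`exists_edge_of_label_le` applies. -/
theorem coeff_mem_span (hI : IsShiftedIdeal I)
    {x : (tableauComplex I).Cell 0 →₀ MvPolynomial (Fin n) K}
    (hx : (tableauComplex I).augmentation K x = 0) (v : GridVertex (tableauCells I))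
    (hv : ∀ w : GridVertex (tableauCells I), x w ≠ 0 → lexRank w ≤ lexRank v) :
    x v ∈ Ideal.span ((fun u => monomial u (1 : K)) ''
      {u | ∃ e : GridEdge (tableauCells I), e.val.2 = v ∧
        u = (tableauComplex I).label (k := 1) e - (tableauComplex I).label (k := 0) v}) := by
  classical
  have hmem : x v * monomial ((tableauComplex I).label (k := 0) v) (1 : K) ∈
      Ideal.span ((fun u => monomial u (1 : K)) ''
        {u | ∃ w : GridVertex (tableauCells I), lexRank w < lexRank v ∧
          u = (tableauComplex I).label (k := 0) w}) := by
    have hsum := (Finset.add_sum_erase Finset.univ (fun w : (tableauComplex I).Cell 0 =>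
      x w * monomial ((tableauComplex I).label w) (1 : K)) (@Finset.mem_univ _ ((tableauComplex I).fintypeCell 0) v)).trans
      (((tableauComplex I).augmentation_apply K x).symm.trans hx)
    rw [eq_neg_of_add_eq_zero_left hsum]
    refine neg_mem (sum_mem fun w hw => ?_)
    by_cases h0 : x w = 0
    · rw [h0, zero_mul]; exact zero_mem _
    · refine Ideal.mul_mem_left _ _ (Ideal.subset_span ⟨_, ⟨w, ?_, rfl⟩, rfl⟩)
      exact lt_of_le_of_ne (hv w h0) fun h => (Finset.mem_erase.mp hw).1 (lexRank_injective h)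
  rw [mem_ideal_span_monomial_image] at hmem ⊢
  intro u hu
  obtain ⟨_, ⟨w, hw, rfl⟩, hle⟩ := hmem (u + (tableauComplex I).label (k := 0) v) (by
    rw [mem_support_iff, coeff_mul_monomial, mul_one]
    exact mem_support_iff.mp hu)
  obtain ⟨e, he, hle'⟩ := hI.exists_edge_of_label_le hw hle
  exact ⟨_, ⟨e, he, rfl⟩, hle'⟩

theorem boundary_edge_snd (e : GridEdge (tableauCells I)) :
    (tableauComplex I).boundary K 0 (Finsupp.single e 1) e.val.2 =
      -monomial ((tableauComplex I).label (k := 1) e -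
        (tableauComplex I).label (k := 0) e.val.2) (1 : K) := by
  refine ((tableauComplex I).boundary_single K (k := 0) e e.val.2).trans ?_
  change monomial _ ((edgeIncidence e e.val.2 : ℤ) : K) = _
  rw [edgeIncidence_snd, Int.cast_neg, Int.cast_one, map_neg]

theorem lexRank_le_of_boundary_edge_ne_zero (e : GridEdge (tableauCells I))
    (w : GridVertex (tableauCells I))
    (h : (tableauComplex I).boundary K 0 (Finsupp.single e 1) w ≠ 0) :
    lexRank w ≤ lexRank e.val.2 := by
  have hinc : edgeIncidence e w ≠ 0 := fun h0 => h (by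
    refine ((tableauComplex I).boundary_single K (k := 0) e w).trans ?_
    change monomial _ ((edgeIncidence e w : ℤ) : K) = 0
    rw [h0, Int.cast_zero, map_zero])
  rcases eq_or_eq_of_edgeIncidence_ne_zero hinc with rfl | rfl
  exacts [(lexRank_lt_of_edge e.2).le, le_rfl]

theorem exact_augmentation (hI : IsShiftedIdeal I) :
    Function.Exact ((tableauComplex I).boundary K 0) ((tableauComplex I).augmentation K) := by
  rw [LinearMap.exact_iff]
  refine le_antisymm ?_ ?_
  swap
  · rintro _ ⟨y, rfl⟩
    exact (tableauComplex I).augmentation_comp_boundary K y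
  refine le_of_filtration_step (vertexRank (I := I)) _ _ ?_ ?_
  · rintro _ ⟨y, rfl⟩
    exact (tableauComplex I).augmentation_comp_boundary K y
  intro k x hx hsupp
  -- If no vertex has rank `k`, the support already lies in smaller ranks and nothing has to be
  -- subtracted.
  by_cases h : ∃ v : GridVertex (tableauCells I), lexRank v = k
  swap
  · exact ⟨0, zero_mem _, fun b hb =>
      lt_of_le_of_ne (hsupp b (by simpa using hb)) fun hk => h ⟨b, hk⟩⟩
  obtain ⟨v, rfl⟩ := h
  have hxv := hI.coeff_mem_span hx v hsupp
  -- The coefficients at `v` of boundaries supported up to `v` form an ideal, so it suffices to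
  -- realize its generators; the negated boundary of an edge ending at `v` does this.
  have hle : Ideal.span ((fun u => monomial u (1 : K)) ''
      {u | ∃ e : GridEdge (tableauCells I), e.val.2 = v ∧
        u = (tableauComplex I).label (k := 1) e - (tableauComplex I).label (k := 0) v}) ≤
      Submodule.map (Finsupp.lapply v) (LinearMap.range ((tableauComplex I).boundary K 0) ⊓
        Finsupp.supported (MvPolynomial (Fin n) K) (MvPolynomial (Fin n) K)
          {w : GridVertex (tableauCells I) | lexRank w ≤ lexRank v}) := by
    refine Ideal.span_le.mpr ?_
    rintro _ ⟨_, ⟨e, rfl, rfl⟩, rfl⟩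
    refine ⟨-(tableauComplex I).boundary K 0 (Finsupp.single e 1),
      neg_mem ⟨LinearMap.mem_range_self _ _, ?_⟩, ?_⟩
    · intro w hw
      exact lexRank_le_of_boundary_edge_ne_zero e w (Finsupp.mem_support_iff.mp hw)
    · exact neg_eq_iff_eq_neg.mpr (boundary_edge_snd e)
  obtain ⟨y, ⟨hy, hys⟩, hyv⟩ := hle hxv
  refine ⟨y, hy, fun b hb => ?_⟩
  have hbv : b ≠ v := by
    rintro rfl
    exact hb ((Finsupp.sub_apply x y b).trans (sub_eq_zero.mpr hyv.symm))
  refine lt_of_le_of_ne ?_ fun h => hbv (lexRank_injective h)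
  by_cases hxb : x b = 0
  · refine hys (Finsupp.mem_support_iff.mpr fun hyb => hb ?_)
    exact (Finsupp.sub_apply x y b).trans (sub_eq_zero.mpr (hxb.trans hyb.symm))
  · exact hsupp b hxb

/-- Among squares of rank at most that of `s`, only `s` itself has `s.edgeDC` as a facet. The
coefficient there is `x s` times a nonzero monomial, so a top coefficient in the kernel vanishes. -/
theorem ker_boundary_one :
    LinearMap.ker ((tableauComplex I).boundary K 1) = ⊥ := by
  rw [eq_bot_iff]
  refine le_of_filtration_step (squareRank (I := I)) _ _ bot_le ?_
  intro k x hx hsupp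
  refine ⟨0, zero_mem _, fun s hs => ?_⟩
  rw [sub_zero] at hs
  refine lt_of_le_of_ne (hsupp s hs) ?_
  rintro rfl
  change GridSquare (tableauCells I) at s
  refine hs ?_
  have hxs : (tableauComplex I).boundary K 1 x s.edgeDC = 0 :=
    DFunLike.congr_fun (LinearMap.mem_ker.mp hx) _
  have hxs' := ((tableauComplex I).boundary_apply_eq_single K x s.edgeDC s ?_).symm.trans hxs
  · refine (mul_eq_zero.mp hxs').resolve_right ?_
    change monomial _ ((squareIncidence s s.edgeDC : ℤ) : K) ≠ 0
    rw [squareIncidence_edgeDC, Int.cast_one]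
    simp
  · intro t ht
    change GridSquare (tableauCells I) at t
    by_contra hn
    rw [not_or] at hn
    have h1 : lexRank t.c ≤ lexRank s.c := hsupp t hn.1
    have h2 : lexRank s.c ≤ lexRank t.c :=
      lexRank_snd_le_of_squareIncidence_ne_zero (s := t) (e := s.edgeDC) hn.2
    exact ht (GridSquare.eq_of_c_eq (lexRank_injective (le_antisymm h1 h2)))

theorem exact_boundary_zero (hI : IsShiftedIdeal I) :
    Function.Exact ((tableauComplex I).boundary K 1) ((tableauComplex I).boundary K 0) := by
  rw [LinearMap.exact_iff]
  refine le_antisymm ?_ ?_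
  swap
  · rintro _ ⟨y, rfl⟩
    exact (tableauComplex I).boundary_comp_boundary K 0 y
  refine le_of_filtration_step (edgeRank (I := I)) _ _ ?_ ?_
  · rintro _ ⟨y, rfl⟩
    exact (tableauComplex I).boundary_comp_boundary K 0 y
  intro k y hy hsupp
  by_cases h : ∃ e : GridEdge (tableauCells I), lexRank e.val.2 = k
  swap
  · exact ⟨0, zero_mem _, fun b hb =>
      lt_of_le_of_ne (hsupp b (by simpa using hb)) fun hk => h ⟨b, hk⟩⟩
  obtain ⟨e, rfl⟩ := h
  change GridEdge (tableauCells I) at e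
  have hyv : (tableauComplex I).boundary K 0 y e.val.2 = 0 :=
    DFunLike.congr_fun (LinearMap.mem_ker.mp hy) _
  -- An edge starting at the top vertex would end at a later one, against the bound on the support.
  -- So only edges ending there contribute to the coefficient of the boundary.
  have hend : ∀ f : GridEdge (tableauCells I), y f ≠ 0 → edgeIncidence f e.val.2 ≠ 0 →
      f.val.2 = e.val.2 := by
    intro f h1 h2
    rcases eq_or_eq_of_edgeIncidence_ne_zero h2 with h | h
    · have h3 : lexRank f.val.2 ≤ lexRank e.val.2 := hsupp f h1
      have h4 := lexRank_lt_of_edge f.2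
      rw [← h] at h4
      omega
    · exact h.symm
  by_cases hs : ∃ s : GridSquare (tableauCells I), s.c = e.val.2
  · obtain ⟨s, hs⟩ := hs
    have hedges : ∀ f : GridEdge (tableauCells I), f.val.2 = e.val.2 →
        f = s.edgeDC ∨ f = s.edgeBC := by
      intro f hf
      rcases f.2 with h | h
      · exact Or.inl (GridEdge.eq_of_below h s.hdc (hf.trans hs.symm))
      · exact Or.inr (GridEdge.eq_of_rightOf h s.hbc (hf.trans hs.symm))
    have hne := (gridSquare_edges_ne s).2.2.2.1
    rw [← hs] at hyv
    replace hyv := ((tableauComplex I).boundary_apply_eq_add K y s.c (P₁ := s.edgeDC)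
      (P₂ := s.edgeBC) hne ?_).symm.trans hyv
    swap
    · intro f h1 h2
      by_contra hn
      rw [not_or] at hn
      rw [hs] at hn
      rcases hedges f (hend f hn.1 hn.2) with h | h
      exacts [h1 h, h2 h]
    have e1 : (tableauComplex I).label (k := 1) s.edgeDC - (tableauComplex I).label (k := 0) s.c =
        Finsupp.single s.c.val.1 1 := hI.label_below_sub (e := s.edgeDC) s.hdc
    have e2 : (tableauComplex I).label (k := 1) s.edgeBC - (tableauComplex I).label (k := 0) s.c =
        Finsupp.single s.c.val.2 1 := hI.label_rightOf_sub (e := s.edgeBC) s.hbc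
    have i1 : (tableauComplex I).incidence (k := 0) s.edgeDC s.c = -1 := edgeIncidence_snd s.edgeDC
    have i2 : (tableauComplex I).incidence (k := 0) s.edgeBC s.c = -1 := edgeIncidence_snd s.edgeBC
    rw [e1, e2, i1, i2, Int.cast_neg, Int.cast_one, map_neg, map_neg] at hyv
    -- The left neighbour of `s.c` is not below the diagonal, so `s.c` is off the diagonal and the
    -- two edge ratios are distinct variables.
    have hij : s.c.val.1 ≠ s.c.val.2 := by
      intro h
      have h1 := Fin.le_def.mp s.b.2.1
      have h2 := s.hbc.1
      have h3 := s.hbc.2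
      have h4 := congrArg Fin.val h
      omega
    -- Both edges have incidence `-1` at `s.c`, hence the sign on the second coefficient. The signs
    -- match those of `s.edgeDC` and `s.edgeBC` in the boundary of `s`, so `t` times that boundary
    -- cancels both coefficients.
    obtain ⟨t, ht1, ht2⟩ := exists_of_mul_X_eq_mul_X hij
      (p := y s.edgeDC) (q := -y s.edgeBC) (by
        change _ * monomial _ 1 = _ * monomial _ 1
        linear_combination -hyv)
    refine ⟨t • (tableauComplex I).boundary K 1 (Finsupp.single s 1),
      Submodule.smul_mem _ _ ⟨_, rfl⟩, fun f hf => ?_⟩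
    change GridEdge (tableauCells I) at f
    replace hf : y f - t * monomial ((tableauComplex I).label (k := 2) s -
        (tableauComplex I).label (k := 1) f) ((tableauComplex I).incidence (k := 1) s f : K) ≠ 0 :=
      fun h0 => hf ((congrArg (fun q => y f - t * q)
        ((tableauComplex I).boundary_single K (k := 1) s f)).trans h0)
    have hlt : f.val.2 ≠ e.val.2 := by
      intro hfe
      rcases hedges f hfe with rfl | rfl
      · have i3 : (tableauComplex I).incidence (k := 1) s s.edgeDC = 1 := squareIncidence_edgeDC s
        rw [i3, hI.label_square_sub_edgeDC, ht1, Int.cast_one] at hf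
        exact hf (sub_self _)
      · have i3 : (tableauComplex I).incidence (k := 1) s s.edgeBC = -1 := squareIncidence_edgeBC s
        rw [i3, hI.label_square_sub_edgeBC, neg_eq_iff_eq_neg.mp ht2, Int.cast_neg, Int.cast_one,
          map_neg, mul_neg] at hf
        exact hf (sub_self _)
    refine lt_of_le_of_ne ?_ fun h => hlt (lexRank_injective h)
    by_cases hyf : y f = 0
    · rw [← hs]
      refine lexRank_snd_le_of_squareIncidence_ne_zero fun h0 => hf ?_
      have i3 : (tableauComplex I).incidence (k := 1) s f = 0 := h0
      rw [hyf, i3, Int.cast_zero, map_zero, mul_zero, sub_zero]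
    · exact hsupp f hyf
  -- Without a square at this vertex, a vertical and a horizontal edge cannot both end here. The
  -- coefficient of the only edge is then annihilated by a nonzero monomial.
  · have huniq : ∀ f g : GridEdge (tableauCells I), f.val.2 = e.val.2 → g.val.2 = e.val.2 →
        f = g := by
      intro f g hf hg
      rcases f.2 with h1 | h1 <;> rcases g.2 with h2 | h2
      · exact GridEdge.eq_of_below h1 h2 (hf.trans hg.symm)
      · rw [hf] at h1
        rw [hg] at h2
        obtain ⟨s, h, -⟩ := hI.shape.exists_square h1 h2
        exact absurd ⟨s, h⟩ hs
      · rw [hf] at h1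
        rw [hg] at h2
        obtain ⟨s, h, -⟩ := hI.shape.exists_square h2 h1
        exact absurd ⟨s, h⟩ hs
      · exact GridEdge.eq_of_rightOf h1 h2 (hf.trans hg.symm)
    refine ⟨0, zero_mem _, fun f hf => ?_⟩
    change GridEdge (tableauCells I) at f
    rw [sub_zero] at hf
    refine lt_of_le_of_ne (hsupp f hf) fun hfe => hf ?_
    have hfe' := lexRank_injective hfe
    rw [← hfe'] at hyv
    replace hyv := ((tableauComplex I).boundary_apply_eq_single K y f.val.2 f ?_).symm.trans hyv
    · refine (mul_eq_zero.mp hyv).resolve_right ?_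
      change monomial _ ((edgeIncidence f f.val.2 : ℤ) : K) ≠ 0
      rw [edgeIncidence_snd]
      simp
    · intro g hg
      by_contra hn
      rw [not_or] at hn
      rw [hfe'] at hn
      exact hg (huniq g f (hend g hn.1 hn.2) hfe')

theorem exact_boundary (hI : IsShiftedIdeal I) :
    ∀ k, Function.Exact ((tableauComplex I).boundary K (k + 1)) ((tableauComplex I).boundary K k)
  | 0 => hI.exact_boundary_zero
  | 1 => by
    intro x
    refine ⟨fun hx => ⟨0, ?_⟩, ?_⟩
    · rw [map_zero]
      have : x ∈ LinearMap.ker ((tableauComplex I).boundary K 1) := hx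
      rw [ker_boundary_one] at this
      exact ((Submodule.mem_bot _).mp this).symm
    · rintro ⟨y, rfl⟩
      exact (tableauComplex I).boundary_comp_boundary K 1 y
  | k + 2 => by
    intro x
    refine ⟨fun _ => ⟨0, ?_⟩, ?_⟩
    · rw [map_zero]
      ext1 b
      exact Empty.elim b
    · rintro ⟨y, rfl⟩
      exact (tableauComplex I).boundary_comp_boundary K _ y

/-- Vertices, edges and squares have labels `m_I` divided by two, one or no variables. The summand 2
on the left avoids truncated subtraction. -/
theorem label_degree_add_two (hI : IsShiftedIdeal I) :
    ∀ k (P : (tableauComplex I).Cell k),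
      ((tableauComplex I).label P).degree + 2 = (lcmExponent I).degree + k
  | 0, v => by
    change GridVertex (tableauCells I) at v
    have h := congrArg Finsupp.degree (tsub_add_cancel_of_le (hI.le_lcm v))
    rw [tableau_label_vertex, ← h]
    simp
  | 1, e => by
    change GridEdge (tableauCells I) at e
    have key : ∀ i : Fin n, Finsupp.single i 1 ≤ lcmExponent I →
        (lcmExponent I - Finsupp.single i 1).degree + 2 = (lcmExponent I).degree + 1 := by
      intro i hi
      have h := congrArg Finsupp.degree (tsub_add_cancel_of_le hi)
      rw [← h]
      simp
    rcases e.2 with h | h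
    · rw [tableau_label_below h]
      exact key _ (le_trans le_add_self (hI.le_lcm e.val.2))
    · rw [tableau_label_rightOf h]
      exact key _ (le_trans le_self_add (hI.le_lcm e.val.2))
  | 2, s => congrArg (fun u => Finsupp.degree u + 2) (tableau_label_square s)
  | _ + 3, P => Empty.elim P

/-- Label degrees rise by exactly one with the dimension, so no matrix entry can be a unit. -/
theorem boundary_entries_mem (hI : IsShiftedIdeal I) (k : ℕ)
    (P : (tableauComplex I).Cell (k + 1)) (Q : (tableauComplex I).Cell k) :
    (tableauComplex I).boundary K k (Finsupp.single P 1) Q ∈ irrelevantIdeal (Fin n) K := by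
  refine LabeledCellComplex.boundary_single_mem_irrelevantIdeal _ _ _ _ ?_
  have h1 := hI.label_degree_add_two _ P
  have h2 := hI.label_degree_add_two _ Q
  omega

end IsShiftedIdeal

end Exactness

/-! ### Minimal generators of equigenerated monomial ideals. -/

section MonomialIdeals

variable {σ K : Type*} [Field K]

theorem monomial_mem_span_iff {E : Set (σ →₀ ℕ)} {u : σ →₀ ℕ} :
    monomial u (1 : K) ∈ Ideal.span ((fun v => monomial v (1 : K)) '' E) ↔ ∃ v ∈ E, v ≤ u := by
  classical
  rw [mem_ideal_span_monomial_image]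
  simp [support_monomial]

/-- Monomials of the same degree minimally generate the ideal that they span. -/
theorem minGenExponents_span_of_degree_eq [Fintype σ] {E : Set (σ →₀ ℕ)} {d : ℕ}
    (hE : ∀ u ∈ E, u.degree = d) :
    minGenExponents (Ideal.span ((fun v => monomial v (1 : K)) '' E)) = E := by
  ext u
  simp only [minGenExponents, Set.mem_ofPred_eq, monomial_mem_span_iff]
  constructor
  · rintro ⟨⟨v, hv, hle⟩, hmin⟩
    rwa [le_antisymm (hmin ⟨v, hv, le_rfl⟩ hle) hle]
  · refine fun hu => ⟨⟨u, hu, le_rfl⟩, ?_⟩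
    rintro w ⟨v, hv, hvw⟩ hwu
    have h := congrArg Finsupp.degree (tsub_add_cancel_of_le (hvw.trans hwu))
    rw [map_add, hE u hu, hE v hv] at h
    have h0 : u - v = 0 := (Finsupp.degree_eq_zero_iff _).mp (by omega)
    exact (tsub_eq_zero_iff_le.mp h0).trans hvw

end MonomialIdeals

/-! ### The specialized Ferrers ideal, its generators and their lcm. -/

section Ferrers

variable {K : Type*} [Field K] {m n : ℕ}

/-- The cells of the shifted tableau with rows `{j : i ≤ j < λ_i}`. -/
def ferrersCells (n : ℕ) (lam : Fin m → ℕ) : Set (Fin n × Fin n) :=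
  {p | p.1 ≤ p.2 ∧ ∃ h : p.1.val < m, p.2.val < lam ⟨p.1.val, h⟩}

/-- The exponent of `x_i x_j`. -/
def pairExponent (p : Fin n × Fin n) : Fin n →₀ ℕ := Finsupp.single p.1 1 + Finsupp.single p.2 1

theorem pairExponent_degree (p : Fin n × Fin n) : (pairExponent p).degree = 2 := by
  simp [pairExponent]

theorem X_mul_X_eq_monomial (p : Fin n × Fin n) :
    (X p.1 * X p.2 : MvPolynomial (Fin n) K) = monomial (pairExponent p) 1 := by
  rw [X, X, monomial_mul, one_mul, pairExponent]

/-- Both monomials have degree two, so divisibility means equality, and the ordering of the indices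
recovers the pair. -/
theorem eq_of_pairExponent_le {p q : Fin n × Fin n} (hp : p.1 ≤ p.2) (hq : q.1 ≤ q.2)
    (h : pairExponent p ≤ pairExponent q) : p = q := by
  have h1 := h p.1
  have h2 := h p.2
  rw [Fin.le_def] at hp hq
  simp only [pairExponent, Finsupp.add_apply, Finsupp.single_apply, Fin.ext_iff, if_true] at h1 h2
  refine Prod.ext (Fin.ext ?_) (Fin.ext ?_) <;> split_ifs at h1 h2 <;> omega

theorem specialization_X_mul_X (hmn : m ≤ n) (i : Fin m) (j : Fin n) :
    specialization K hmn (X (Sum.inl i) * X (Sum.inr j)) =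
      monomial (pairExponent (Fin.castLE hmn i, j)) (1 : K) := by
  rw [← X_mul_X_eq_monomial, specialization, map_mul, aeval_X, aeval_X, Sum.elim_inl,
    Sum.elim_inr]

theorem specializedFerrersIdeal_eq_span (hmn : m ≤ n) (lam : Fin m → ℕ) :
    specializedFerrersIdeal K hmn lam =
      Ideal.span ((fun u => monomial u (1 : K)) '' (pairExponent '' ferrersCells n lam)) := by
  rw [specializedFerrersIdeal, generalizedFerrersIdeal, Ideal.map_span]
  congr 1
  ext f
  constructor
  · rintro ⟨_, ⟨i, j, h1, h2, rfl⟩, rfl⟩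
    -- With `μ_i = i` for the zero-based row, `μ_i < j + 1` is the condition `i ≤ j`.
    exact ⟨_, ⟨(Fin.castLE hmn i, j), ⟨Fin.le_def.mpr (Nat.le_of_lt_succ h1), i.isLt, h2⟩, rfl⟩,
      (specialization_X_mul_X hmn i j).symm⟩
  · rintro ⟨_, ⟨⟨i, j⟩, ⟨h1, h2, h3⟩, rfl⟩, rfl⟩
    refine ⟨_, ⟨⟨i.val, h2⟩, j, Nat.lt_succ_of_le (Fin.le_def.mp h1), ?_, rfl⟩,
      specialization_X_mul_X hmn ⟨i.val, h2⟩ j⟩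
    exact h3

theorem tableauCells_specializedFerrersIdeal (hmn : m ≤ n) (lam : Fin m → ℕ) :
    tableauCells (specializedFerrersIdeal K hmn lam) = ferrersCells n lam := by
  ext p
  rw [Set.mem_ofPred_eq, X_mul_X_eq_monomial, specializedFerrersIdeal_eq_span,
    monomial_mem_span_iff]
  constructor
  · rintro ⟨hp, _, ⟨q, hq, rfl⟩, hle⟩
    rwa [← eq_of_pairExponent_le hq.1 hp hle]
  · exact fun hp => ⟨hp.1, _, ⟨p, hp, rfl⟩, le_rfl⟩

theorem minGenExponents_specializedFerrersIdeal (hmn : m ≤ n) (lam : Fin m → ℕ) :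
    minGenExponents (specializedFerrersIdeal K hmn lam) = pairExponent '' ferrersCells n lam := by
  rw [specializedFerrersIdeal_eq_span, minGenExponents_span_of_degree_eq (d := 2)]
  rintro _ ⟨p, -, rfl⟩
  exact pairExponent_degree p

theorem le_part_of_antitone {lam : Fin m → ℕ} (hm : 0 < m) (hanti : Antitone lam)
    (hmu : m - 1 < lam ⟨m - 1, Nat.sub_lt hm Nat.one_pos⟩) (i : Fin m) : m ≤ lam i := by
  have h : lam ⟨m - 1, Nat.sub_lt hm Nat.one_pos⟩ ≤ lam i :=
    hanti (Fin.le_def.mpr (by simp only; omega))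
  omega

/-- In a generator `x_i x_j` the first index ranges below `m` and the second below `λ_1`, which
bounds the exponent of each variable. An attained maximum is what makes the `sSup` in `lcmExponent`
computable. -/
theorem isGreatest_pairExponent (hm : 0 < m) (hmn : m ≤ n) {lam : Fin m → ℕ}
    (hanti : Antitone lam) (hmu : m - 1 < lam ⟨m - 1, Nat.sub_lt hm Nat.one_pos⟩) (k : Fin n) :
    IsGreatest ((fun u : Fin n →₀ ℕ => u k) '' (pairExponent '' ferrersCells n lam))
      ((if k.val < m then 1 else 0) + (if k.val < lam ⟨0, hm⟩ then 1 else 0)) := by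
  have hlam := le_part_of_antitone hm hanti hmu
  have hlam0 := hlam ⟨0, hm⟩
  have hn0 : 0 < n := by omega
  constructor
  · have key : ∀ p ∈ ferrersCells n lam, pairExponent p k =
        (if k.val < m then 1 else 0) + (if k.val < lam ⟨0, hm⟩ then 1 else 0) →
        (if k.val < m then 1 else 0) + (if k.val < lam ⟨0, hm⟩ then 1 else 0) ∈
          (fun u : Fin n →₀ ℕ => u k) '' (pairExponent '' ferrersCells n lam) :=
      fun p hp h => ⟨_, ⟨p, hp, rfl⟩, h⟩
    -- The maximum 2 is reached at `x_k^2`, which is a generator since every part is at least `m`;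
    -- the maximum 1 at the product of the first variable with `x_k`; and 0 at the square of the
    -- first variable, as `k ≥ m > 0`.
    by_cases h1 : k.val < m
    · refine key (k, k) ⟨le_rfl, h1, lt_of_lt_of_le h1 (hlam _)⟩ ?_
      simp only [pairExponent, Finsupp.add_apply, Finsupp.single_apply, if_true, h1,
        h1.trans_le hlam0]
    by_cases h2 : k.val < lam ⟨0, hm⟩
    · refine key (⟨0, hn0⟩, k) ⟨Fin.le_def.mpr (Nat.zero_le _), hm, h2⟩ ?_
      simp only [pairExponent, Finsupp.add_apply, Finsupp.single_apply, Fin.ext_iff, if_true, h1,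
        h2]
      rw [if_neg (by omega), if_neg not_false]
    · refine key (⟨0, hn0⟩, ⟨0, hn0⟩) ⟨le_rfl, hm, lt_of_lt_of_le hm (hlam _)⟩ ?_
      simp only [pairExponent, Finsupp.add_apply, Finsupp.single_apply, Fin.ext_iff, h1, h2]
      rw [if_neg (by omega), if_neg not_false]
  · rintro _ ⟨_, ⟨p, ⟨h1, h2, h3⟩, rfl⟩, rfl⟩
    have h4 : lam ⟨p.1.val, h2⟩ ≤ lam ⟨0, hm⟩ := hanti (Fin.le_def.mpr (Nat.zero_le _))
    rw [Fin.le_def] at h1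
    simp only [pairExponent, Finsupp.add_apply, Finsupp.single_apply, Fin.ext_iff]
    split_ifs <;> omega

theorem lcmExponent_specializedFerrersIdeal_apply (hm : 0 < m) (hmn : m ≤ n) {lam : Fin m → ℕ}
    (hanti : Antitone lam) (hmu : m - 1 < lam ⟨m - 1, Nat.sub_lt hm Nat.one_pos⟩) (k : Fin n) :
    lcmExponent (specializedFerrersIdeal K hmn lam) k =
      (if k.val < m then 1 else 0) + (if k.val < lam ⟨0, hm⟩ then 1 else 0) := by
  rw [← (isGreatest_pairExponent hm hmn hanti hmu k).csSup_eq,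
    ← minGenExponents_specializedFerrersIdeal (K := K) hmn lam]
  rfl

theorem sum_ite_val_lt {a : ℕ} (ha : a ≤ n) : ∑ k : Fin n, (if k.val < a then 1 else 0) = a := by
  rw [Fin.sum_univ_eq_sum_range (fun k => if k < a then 1 else 0) n, ← Finset.sum_filter,
    Finset.sum_const, smul_eq_mul, mul_one]
  have : {k ∈ Finset.range n | k < a} = Finset.range a := by
    ext k
    simp only [Finset.mem_filter, Finset.mem_range]
    omega
  rw [this, Finset.card_range]

theorem lcmExponent_specializedFerrersIdeal_degree (hm : 0 < m) (hmn : m ≤ n) {lam : Fin m → ℕ}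
    (hanti : Antitone lam) (hmu : m - 1 < lam ⟨m - 1, Nat.sub_lt hm Nat.one_pos⟩)
    (hn : lam ⟨0, hm⟩ ≤ n) :
    (lcmExponent (specializedFerrersIdeal K hmn lam)).degree = m + lam ⟨0, hm⟩ := by
  rw [Finsupp.degree_eq_sum]
  simp only [lcmExponent_specializedFerrersIdeal_apply hm hmn hanti hmu]
  rw [Finset.sum_add_distrib, sum_ite_val_lt hmn, sum_ite_val_lt hn]

theorem isShiftedIdeal_specializedFerrersIdeal (hm : 0 < m) (hmn : m ≤ n) {lam : Fin m → ℕ}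
    (hanti : Antitone lam) (hmu : m - 1 < lam ⟨m - 1, Nat.sub_lt hm Nat.one_pos⟩) :
    IsShiftedIdeal (specializedFerrersIdeal K hmn lam) where
  shape := by
    rw [tableauCells_specializedFerrersIdeal]
    refine ⟨fun p hp => hp.1, ?_, ?_⟩
    · rintro i j ⟨h1, h2, h3⟩ i' hi
      exact ⟨hi.trans h1, lt_of_le_of_lt (Fin.le_def.mp hi) h2,
        lt_of_lt_of_le h3 (hanti (Fin.le_def.mpr (Fin.le_def.mp hi)))⟩
    · rintro i j ⟨h1, h2, h3⟩ j' hj hij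
      exact ⟨hij, h2, lt_of_le_of_lt (Fin.le_def.mp hj) h3⟩
  le_lcm := fun v k => by
    rw [lcmExponent_specializedFerrersIdeal_apply hm hmn hanti hmu]
    refine (isGreatest_pairExponent hm hmn hanti hmu k).2 ⟨_, ⟨v.val, ?_, rfl⟩, rfl⟩
    rw [← tableauCells_specializedFerrersIdeal (K := K) hmn lam]
    exact v.2

theorem range_augmentation_ferrersComplex (hmn : m ≤ n) (lam : Fin m → ℕ) :
    LinearMap.range ((ferrersComplex K hmn lam).augmentation K) =
      lcmDual (specializedFerrersIdeal K hmn lam) := by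
  rw [LabeledCellComplex.range_augmentation, lcmDual, minGenExponents_specializedFerrersIdeal,
    ← tableauCells_specializedFerrersIdeal (K := K) hmn lam]
  congr 1
  ext f
  constructor
  · rintro ⟨_, ⟨v, rfl⟩, rfl⟩
    change GridVertex (tableauCells (specializedFerrersIdeal K hmn lam)) at v
    exact ⟨_, ⟨v.val, v.2, rfl⟩, congrArg (fun u => monomial u (1 : K))
      (tableau_label_vertex v).symm⟩
  · rintro ⟨_, ⟨p, hp, rfl⟩, rfl⟩
    let v : GridVertex (tableauCells (specializedFerrersIdeal K hmn lam)) := ⟨p, hp⟩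
    exact ⟨_, ⟨v, rfl⟩, congrArg (fun u => monomial u (1 : K)) (tableau_label_vertex v)⟩

end Ferrers

end LCMDual

end

/-! ### Assembly of the resolution. -/

open LCMDual in
theorem mainTheorem2 (K : Type*) [Field K] (m n : ℕ) (hm : 0 < m) (hmn : m ≤ n)
    (lam : Fin m → ℕ) (hanti : Antitone lam)
    (hmu : m - 1 < lam ⟨m - 1, Nat.sub_lt hm Nat.one_pos⟩) (hn : lam ⟨0, hm⟩ ≤ n) :
    -- the image of `∂₀` lies in the LCM-dual, and the complex is a minimal free resolution of it
    (∃ h : ∀ x, (ferrersComplex K hmn lam).augmentation K x ∈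
        lcmDual (specializedFerrersIdeal K hmn lam),
      IsMinimalFreeResolution ((ferrersComplex K hmn lam).boundary K)
        (LinearMap.codRestrict (lcmDual (specializedFerrersIdeal K hmn lam))
          ((ferrersComplex K hmn lam).augmentation K) h)) ∧
    -- the resolution is multigraded, with the labels as degrees of the basis elements
    IsMultigraded (fun k (P : (ferrersComplex K hmn lam).Cell k) =>
        (ferrersComplex K hmn lam).label P)
      ((ferrersComplex K hmn lam).boundary K) ((ferrersComplex K hmn lam).augmentation K) ∧
    -- the module in position `k` is a power of `R(-(m+λ₁-2+k))`, and vanishes for `k > 2`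
    (∀ k (P : (ferrersComplex K hmn lam).Cell k),
      ((ferrersComplex K hmn lam).label P).degree + 2 = m + lam ⟨0, hm⟩ + k) ∧
    (∀ k, 2 < k → IsEmpty ((ferrersComplex K hmn lam).Cell k)) ∧
    -- with `R` included, the complex resolves the quotient, minimally unless `λ = (1)`
    Function.Exact ((ferrersComplex K hmn lam).augmentation K)
      (lcmDual (specializedFerrersIdeal K hmn lam)).mkQ ∧
    (lam ⟨0, hm⟩ ≠ 1 →
      ∀ x, (ferrersComplex K hmn lam).augmentation K x ∈ irrelevantIdeal (Fin n) K) := by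
  have hI := isShiftedIdeal_specializedFerrersIdeal (K := K) hm hmn hanti hmu
  have hrange := range_augmentation_ferrersComplex (K := K) hmn lam
  have hdeg : ∀ k (P : (ferrersComplex K hmn lam).Cell k),
      ((ferrersComplex K hmn lam).label P).degree + 2 = m + lam ⟨0, hm⟩ + k := fun k P => by
    rw [← lcmExponent_specializedFerrersIdeal_degree (K := K) hm hmn hanti hmu hn]
    exact hI.label_degree_add_two k P
  have hmem : ∀ x, (ferrersComplex K hmn lam).augmentation K x ∈
      lcmDual (specializedFerrersIdeal K hmn lam) := fun x => by
    rw [← hrange]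
    exact LinearMap.mem_range_self _ x
  refine ⟨⟨hmem, ?_, ?_, hI.exact_boundary, hI.boundary_entries_mem⟩,
    LabeledCellComplex.isMultigraded _ K, hdeg, ?_, ?_, ?_⟩
  · rintro ⟨y, hy⟩
    rw [← hrange] at hy
    obtain ⟨x, hx⟩ := hy
    exact ⟨x, Subtype.ext hx⟩
  · intro x
    rw [← hI.exact_augmentation x]
    exact Subtype.ext_iff
  · rintro (_ | _ | _ | k) hk
    · omega
    · omega
    · omega
    · exact inferInstanceAs (IsEmpty Empty)
  · intro x
    rw [Submodule.mkQ_apply, Submodule.Quotient.mk_eq_zero, ← hrange]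
    rfl
  -- A vertex label equal to 1 would force `m + λ_1 = 2`; as `1 ≤ m ≤ λ_1`, this gives `λ_1 = 1`,
  -- the excluded case.
  · intro h1 x
    have hlam := le_part_of_antitone hm hanti hmu ⟨0, hm⟩
    rw [LabeledCellComplex.augmentation_apply]
    refine sum_mem fun v _ => Ideal.mul_mem_left _ _ (monomial_mem_irrelevantIdeal ?_ _)
    intro h0
    have := hdeg 0 v
    rw [h0, map_zero] at this
    omega
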